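/- Let $\{C_i\}_{i\ge 1}$ be an infinite sequence of circles of radius $\tfrac12$ in $\mathbb{R}^2$ that bound pairwise disjoint open disks. Its penny graph has the centers of the circles as vertices and, as edges, the unit segments that join the centers of two tangent circles. Its faces are the connected components of the complement in $\mathbb{R}^2$ of the union of all vertices and edges. The facial degree $\deg(\sigma)\in\mathbb{N}\cup\{\infty\}$ of a face $\sigma$ is the number of its corners (interior angles), where a vertex at which $\sigma$ has several interior angles is counted once for each of them. For a face $\sigma$, call the vertices in $\overline{\sigma}$ and the edges in $\partial\sigma$ the vertices and edges of the polygon $\overline{\sigma}$. A diagonal segment of $\overline{\sigma}$ is a segment $[v,w]\subset\overline{\sigma}$ between two distinct vertices of $\overline{\sigma}$ that is not an edge, contains no vertex of $\overline{\sigma}$ other than $v$ and $w$, and does not meet $\partial\sigma$ except at $v$ and $w$. A diagonal triangulation of $\overline{\sigma}$ is a finite geometric simplicial complex with underlying space $\overline{\sigma}$ whose vertices are the vertices of $\overline{\sigma}$ and whose edges are all the edges of $\overline{\sigma}$ together with some diagonal segments of $\overline{\sigma}$. An associated triangulation of the penny graph is a locally finite geometric simplicial complex with underlying space $\mathbb{R}^2$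 whose vertices are the penny centers and which is the union, over all faces $\sigma$, of a diagonal triangulation of each $\overline{\sigma}$. **Lemma.** For every $D\in\mathbb{N}$ there is a constant $C(D)>0$, depending only on $D$, such that every connected infinite penny graph with $\sup_\sigma\deg(\sigma)\le D$ has an associated triangulation such that, for every triangle of it with vertices $v_1,v_2,v_3$ and all distinct $i,j,k\in\{1,2,3\}$, $$\angle v_iv_jv_k\ \ge\ \frac{1}{C(D)},\qquad 1\le |v_i-v_j|\le C(D).$$ -/

import Mathlib

/-- The Euclidean plane. -/
abbrev Plane : Type := EuclideanSpace ℝ (Fin 2)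

/-- A sequence of pennies: open disks of radius `1/2` in the plane, given by their centers,
that are pairwise disjoint. -/
structure PennyConfiguration where
  center : ℕ → Plane
  disjoint_disks : Pairwise fun i j =>
    Disjoint (Metric.ball (center i) (1 / 2)) (Metric.ball (center j) (1 / 2))

namespace PennyConfiguration

/-- The open disk bounded by the `i`-th circle. -/
def disk (P : PennyConfiguration) (i : ℕ) : Set Plane :=
  Metric.ball (P.center i) (1 / 2)

/-- The contact graph. Two circles of radius `1/2` that bound disjoint disks are tangent exactly
when their centers are at distance `1/2 + 1/2 = 1`. -/
def graph (P : PennyConfiguration) : SimpleGraph ℕ where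
  Adj i j := dist (P.center i) (P.center j) = 1
  symm := ⟨fun i j (h : dist (P.center i) (P.center j) = 1) => by rwa [dist_comm]⟩
  loopless := ⟨fun i (h : dist (P.center i) (P.center i) = 1) => by simp at h⟩

/-- The set of penny centers, i.e. of the embedded vertices. -/
def vertexSet (P : PennyConfiguration) : Set Plane :=
  Set.range P.center

/-- The image of the embedded graph: all vertices, and all segments that join the centers of
two tangent circles. -/
def skeleton (P : PennyConfiguration) : Set Plane :=
  P.vertexSet ∪
    {x | ∃ i j, P.graph.Adj i j ∧ x ∈ segment ℝ (P.center i) (P.center j)}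

/-- The faces: the connected components of the complement of the embedded graph. -/
def faceSet (P : PennyConfiguration) : Set (Set Plane) :=
  {σ | ∃ x ∈ P.skeletonᶜ, σ = connectedComponentIn P.skeletonᶜ x}

/-- The sectors at the `i`-th vertex: the connected components of the `i`-th open disk minus the
embedded graph. An edge that does not end at the `i`-th vertex stays at distance at least
`√3 / 2 > 1 / 2` from it, so only the edges at the `i`-th vertex cut the disk. -/
def sectors (P : PennyConfiguration) (i : ℕ) : Set (Set Plane) :=
  {s | ∃ x ∈ P.disk i \ P.skeleton, s = connectedComponentIn (P.disk i \ P.skeleton) x}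

/-- The corners (interior angles) of a face `σ`: a vertex together with a sector at this vertex
that lies in `σ`. A vertex at which `σ` has several interior angles gives several corners. -/
def corners (P : PennyConfiguration) (σ : Set Plane) : Set (ℕ × Set Plane) :=
  {q | q.2 ∈ P.sectors q.1 ∧ q.2 ⊆ σ}

/-- The facial degree of a face: the number of its corners. -/
noncomputable def facialDegree (P : PennyConfiguration) (σ : Set Plane) : ℕ∞ :=
  (P.corners σ).encard

/-- The supremum of all facial degrees. -/
noncomputable def supFacialDegree (P : PennyConfiguration) : ℕ∞ :=
  ⨆ σ ∈ P.faceSet, P.facialDegree σ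

/-- The vertices of the closed polygon `closure σ`, for a face `σ`. -/
def faceVertices (P : PennyConfiguration) (σ : Set Plane) : Set Plane :=
  P.vertexSet ∩ closure σ

/-- `v` and `w` are the endpoints of an edge of the closed polygon `closure σ`: an edge of the
penny graph that lies on the boundary of the face `σ`. -/
def IsFaceEdge (P : PennyConfiguration) (σ : Set Plane) (v w : Plane) : Prop :=
  (∃ i j, P.graph.Adj i j ∧ P.center i = v ∧ P.center j = w) ∧ segment ℝ v w ⊆ frontier σ

/-- `[v, w]` is a diagonal segment of the closed polygon `closure σ`: it joins two distinct
vertices of the polygon, lies in the polygon, is not an edge, and contains no further vertex of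
the polygon. The last clause says that it does not cross the boundary of the face; it only matters
at an edge of the penny graph that has the face `σ` on both of its sides. -/
def IsDiagonalSegment (P : PennyConfiguration) (σ : Set Plane) (v w : Plane) : Prop :=
  v ≠ w ∧ segment ℝ v w ⊆ closure σ ∧ ¬ P.IsFaceEdge σ v w ∧
    segment ℝ v w ∩ P.faceVertices σ = {v, w} ∧
    openSegment ℝ v w ∩ frontier σ = ∅

/-- `L` is a diagonal triangulation of the closed polygon `closure σ`: a finite triangulation of
it on its vertices whose edges are edges or diagonal segments of the polygon, and all edges of the
polygon occur. -/
structure IsDiagonalTriangulation (P : PennyConfiguration) (σ : Set Plane)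
    (L : Geometry.SimplicialComplex ℝ Plane) : Prop where
  finite_faces : L.faces.Finite
  space_eq : L.space = closure σ
  vertices_eq : L.vertices = P.faceVertices σ
  edge_or_diagonal : ∀ s ∈ L.faces, s.card = 2 → ∀ v ∈ s, ∀ w ∈ s, v ≠ w →
    P.IsFaceEdge σ v w ∨ P.IsDiagonalSegment σ v w
  edge_mem : ∀ v w, P.IsFaceEdge σ v w → ∃ s ∈ L.faces, (s : Set Plane) = {v, w}

/-- `K` is an associated triangulation of the plane for the penny graph: a locally finite
triangulation of the whole plane, whose vertices are the penny centers, and whose simplices are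
those of diagonal triangulations `T σ` of the faces `σ`. -/
structure IsAssociatedTriangulation (P : PennyConfiguration)
    (K : Geometry.SimplicialComplex ℝ Plane) : Prop where
  locallyFinite : LocallyFinite fun s : K.faces => convexHull ℝ ((s : Finset Plane) : Set Plane)
  space_eq : K.space = Set.univ
  vertices_eq : K.vertices = P.vertexSet
  exists_diagonal : ∃ T : Set Plane → Geometry.SimplicialComplex ℝ Plane,
    (∀ σ ∈ P.faceSet, P.IsDiagonalTriangulation σ (T σ)) ∧
      K.faces = ⋃ σ ∈ P.faceSet, (T σ).faces

end PennyConfiguration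

/-!
A weighted Delaunay triangulation of the set of penny centers is an associated triangulation.

*The centers are relatively dense* (`PennyConfiguration.exists_vertex_dist_le`). A point off the
graph at distance less than `√3 / 2` from a vertex can be joined to that vertex without meeting the
graph, so every vertex near the frontier of a face is a vertex of its closed polygon and carries a
corner. The frontier of a face is therefore covered by at most `D` disks of radius `1 / 2`. Hence
the face is bounded, and projecting a disk inside it to the first coordinate axis shows that the
disk has diameter at most `D`. So every point is at distance at most `D / 2 + 1` from a center.

*The triangulation.* The Delaunay triangulation contains every unit edge, because the closed disk
that has such an edge as diameter contains no further center. As centers may be cocircular, each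
center `p` gets a weight `w p ∈ (0, 1 / 8]`, with generic weights (`exists_isGenericWeight`), small
enough for the unit edges to survive (`isPowerCell_pair`). Simplices are then the sets on which a
power function `dist p c ^ 2 + w p` attains its minimum over the centers, and they fit together
because differences of power functions are affine (`IsPowerCell.convexHull_inter_subset`). That they
cover the plane is an extremal argument (`exists_isPowerCell_affineSpan_eq_top`).

*The bounds.* The vertices of a triangle lie almost on a circle whose radius is at most
`M = D / 2 + 2`, and they are at mutual distance at least `1`. This bounds the sides by `2 * M` and,
by an approximate law of sines (`le_angle_of_dist_sq_sub_le`), the angles from below.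

*Faces.* As the graph is a subcomplex of the triangulation, the relative interior of each triangle
lies in a single face, and the simplices inside a closed polygon form its diagonal triangulation
(`PennyConfiguration.IsCompatible.isDiagonalTriangulation`).
-/

open Set Filter Topology Module

/-! ### Power cells and generic weights -/

section PowerCells

variable {E : Type*} [NormedAddCommGroup E] [InnerProductSpace ℝ E]

/-- A finite subset `t` of `V` is a power cell for the weights `w` if, for some center `c`, the
power function `p ↦ dist p c ^ 2 + w p` on `V` attains its minimum exactly on `t`. For `w = 0`
this says that `t` consists of the points of `V` on a sphere whose open ball contains no point of
`V`. -/
def IsPowerCell (V : Set E) (w : E → ℝ) (t : Finset E) : Prop :=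
  (t : Set E) ⊆ V ∧ ∃ (c : E) (ρ : ℝ),
    (∀ p ∈ t, dist p c ^ 2 + w p = ρ) ∧ ∀ p ∈ V, p ∉ t → ρ < dist p c ^ 2 + w p

theorem dist_sq_sub_dist_sq (y c c' : E) :
    dist y c ^ 2 - dist y c' ^ 2 = 2 * inner ℝ y (c' - c) + (‖c‖ ^ 2 - ‖c'‖ ^ 2) := by
  rw [dist_eq_norm, dist_eq_norm, norm_sub_sq_real, norm_sub_sq_real, inner_sub_right]
  ring

/-- The difference of two power functions with the same weights is an affine function, hence
commutes with affine combinations. -/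
theorem sum_mul_dist_sq_sub_dist_sq {s : Finset E} {a : E → ℝ} {x : E} (ha : ∑ p ∈ s, a p = 1)
    (hx : ∑ p ∈ s, a p • p = x) (c c' : E) :
    ∑ p ∈ s, a p * (dist p c ^ 2 - dist p c' ^ 2) = dist x c ^ 2 - dist x c' ^ 2 := by
  simp only [dist_sq_sub_dist_sq, mul_add, Finset.sum_add_distrib, ← Finset.sum_mul, ha, one_mul]
  rw [← hx, sum_inner, Finset.mul_sum]
  congr 1
  refine Finset.sum_congr rfl fun p _ => ?_
  rw [real_inner_smul_left]
  ring

theorem mem_convexHull_of_forall_ne_zero {s : Finset E} {a : E → ℝ} {x : E} {S : Set E}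
    (h0 : ∀ p ∈ s, 0 ≤ a p) (ha : ∑ p ∈ s, a p = 1) (hx : ∑ p ∈ s, a p • p = x)
    (hS : ∀ p ∈ s, a p ≠ 0 → p ∈ S) : x ∈ convexHull ℝ S := by
  classical
  have h1 : ∑ p ∈ s with a p ≠ 0, a p = 1 := by rw [Finset.sum_filter_ne_zero, ha]
  have h2 : ∑ p ∈ s with a p ≠ 0, a p • p = x := by
    rw [← hx]
    refine Finset.sum_filter_of_ne fun p _ hp h => hp ?_
    rw [h, zero_smul]
  rw [← h2]
  refine (convex_convexHull ℝ S).sum_mem (fun p hp => h0 p (Finset.mem_filter.1 hp).1) h1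
    fun p hp => subset_convexHull ℝ S ?_
  exact hS p (Finset.mem_filter.1 hp).1 (Finset.mem_filter.1 hp).2

/-- The affine function that is the difference of the two (shifted) power functions is nonpositive
on `s`, where it vanishes only on `s ∩ t`, and nonnegative on `t`. So it vanishes at a common
point `x`, and a convex combination of `s` representing `x` is supported on `s ∩ t`. -/
theorem IsPowerCell.convexHull_inter_subset {V : Set E} {w : E → ℝ} {s t : Finset E}
    (hs : IsPowerCell V w s) (ht : IsPowerCell V w t) :
    convexHull ℝ (s : Set E) ∩ convexHull ℝ (t : Set E) ⊆ convexHull ℝ ((s : Set E) ∩ t) := by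
  obtain ⟨hsV, c, ρ, hc, hc'⟩ := hs
  obtain ⟨htV, d, η, hd, hd'⟩ := ht
  rintro x ⟨hxs, hxt⟩
  obtain ⟨a, ha0, ha1, hax⟩ := Finset.mem_convexHull'.1 hxs
  obtain ⟨b, hb0, hb1, hbx⟩ := Finset.mem_convexHull'.1 hxt
  have hle : ∀ p ∈ s, dist p c ^ 2 - dist p d ^ 2 - (ρ - η) ≤ 0 := by
    intro p hp
    have h1 := hc p hp
    by_cases hpt : p ∈ t
    · linarith [hd p hpt]
    · linarith [hd' p (hsV hp) hpt]
  have hge : ∀ p ∈ t, 0 ≤ dist p c ^ 2 - dist p d ^ 2 - (ρ - η) := by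
    intro p hp
    have h1 := hd p hp
    by_cases hpt : p ∈ s
    · linarith [hc p hpt]
    · linarith [hc' p (htV hp) hpt]
  have hS : ∑ p ∈ s, a p * (dist p c ^ 2 - dist p d ^ 2 - (ρ - η))
      = dist x c ^ 2 - dist x d ^ 2 - (ρ - η) := by
    simp only [mul_sub _ _ (ρ - η), Finset.sum_sub_distrib, ← Finset.sum_mul, ha1, one_mul,
      sum_mul_dist_sq_sub_dist_sq ha1 hax]
  have hT : ∑ p ∈ t, b p * (dist p c ^ 2 - dist p d ^ 2 - (ρ - η))
      = dist x c ^ 2 - dist x d ^ 2 - (ρ - η) := by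
    simp only [mul_sub _ _ (ρ - η), Finset.sum_sub_distrib, ← Finset.sum_mul, hb1, one_mul,
      sum_mul_dist_sq_sub_dist_sq hb1 hbx]
  have hT0 : 0 ≤ dist x c ^ 2 - dist x d ^ 2 - (ρ - η) :=
    hT ▸ Finset.sum_nonneg fun p hp => mul_nonneg (hb0 p hp) (hge p hp)
  have hnp : ∀ p ∈ s, a p * (dist p c ^ 2 - dist p d ^ 2 - (ρ - η)) ≤ 0 := fun p hp =>
    mul_nonpos_of_nonneg_of_nonpos (ha0 p hp) (hle p hp)
  have hz := (Finset.sum_eq_zero_iff_of_nonpos hnp).1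
    (le_antisymm (Finset.sum_nonpos hnp) (hS ▸ hT0))
  refine mem_convexHull_of_forall_ne_zero ha0 ha1 hax fun p hp hap => ⟨hp, ?_⟩
  by_contra hpt
  have h1 := (mul_eq_zero.1 (hz p hp)).resolve_left hap
  have h2 := hc p hp
  have h3 := hd' p (hsV hp) hpt
  linarith

/-- The weights `w` are generic for `V`: no simplex of full dimension with vertices in `V` has a
further point of `V` on its weighted circumsphere. This forces every power cell that spans the
space to be a simplex. -/
def IsGenericWeight (V : Set E) (w : E → ℝ) : Prop :=
  ∀ t : Finset E, (t : Set E) ⊆ V → AffineIndependent ℝ ((↑) : t → E) →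
    t.card = finrank ℝ E + 1 → ∀ p ∈ V, p ∉ t → ∀ (c : E) (ρ : ℝ),
      (∀ q ∈ t, dist q c ^ 2 + w q = ρ) → dist p c ^ 2 + w p ≠ ρ

theorem exists_weights_of_affineSpan_eq_top [FiniteDimensional ℝ E] {t : Finset E}
    (h : AffineIndependent ℝ ((↑) : t → E)) (hcard : t.card = finrank ℝ E + 1) (p : E) :
    ∃ l : E → ℝ, ∑ q ∈ t, l q = 1 ∧ ∑ q ∈ t, l q • q = p := by
  have htop : affineSpan ℝ (Set.range ((↑) : t → E)) = ⊤ :=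
    h.affineSpan_eq_top_iff_card_eq_finrank_add_one.2 (by simpa using hcard)
  have hp : p ∈ affineSpan ℝ (Set.range ((↑) : t → E)) := by rw [htop]; trivial
  classical
  obtain ⟨l, hl, hlp⟩ := eq_affineCombination_of_mem_affineSpan_of_fintype hp
  rw [Finset.affineCombination_eq_linear_combination _ _ _ hl] at hlp
  refine ⟨fun q => if hq : q ∈ t then l ⟨q, hq⟩ else 0, ?_, ?_⟩
  · rw [← hl, ← Finset.sum_coe_sort]
    simp
  · rw [hlp, ← Finset.sum_coe_sort t]
    simp

/-- For the weights `ε * s ^ (e p + 1)`, a coincidence between `t` and `p` is a polynomial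
equation in `s`; since `e` is injective, the monomial of degree `e p + 1` does not cancel. -/
theorem finite_setOf_not_generic [FiniteDimensional ℝ E] {V : Set E} {e : E → ℕ}
    (he : InjOn e V) {ε : ℝ} (hε : 0 < ε) {t : Finset E} (htV : (t : Set E) ⊆ V)
    (h : AffineIndependent ℝ ((↑) : t → E)) (hcard : t.card = finrank ℝ E + 1)
    {p : E} (hp : p ∈ V) (hpt : p ∉ t) :
    {s : ℝ | ∃ (c : E) (ρ : ℝ), (∀ q ∈ t, dist q c ^ 2 + ε * s ^ (e q + 1) = ρ) ∧
      dist p c ^ 2 + ε * s ^ (e p + 1) = ρ}.Finite := by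
  obtain ⟨l, hl, hlp⟩ := exists_weights_of_affineSpan_eq_top h hcard p
  let f : Polynomial ℝ := Polynomial.monomial (e p + 1) ε -
    ∑ q ∈ t, Polynomial.monomial (e q + 1) (l q * ε) +
    Polynomial.C (‖p‖ ^ 2 - ∑ q ∈ t, l q * ‖q‖ ^ 2)
  have hf : f ≠ 0 := by
    intro hf0
    have h1 : f.coeff (e p + 1) = 0 := by rw [hf0, Polynomial.coeff_zero]
    have h2 : ∑ q ∈ t, (Polynomial.monomial (e q + 1) (l q * ε)).coeff (e p + 1) = 0 := by
      refine Finset.sum_eq_zero fun q hq => ?_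
      refine Polynomial.coeff_monomial_of_ne _ fun hne => hpt ?_
      rwa [he hp (htV hq) (by omega)]
    simp only [f, Polynomial.coeff_add, Polynomial.coeff_sub, Polynomial.coeff_monomial_same,
      Polynomial.finsetSum_coeff, h2, Polynomial.coeff_C_succ] at h1
    linarith
  refine (Polynomial.finite_setOfPred_isRoot hf).subset ?_
  rintro s ⟨c, ρ, hq, hps⟩
  have key := sum_mul_dist_sq_sub_dist_sq hl hlp c 0
  simp only [dist_zero_right] at key
  have h1 : ∀ q ∈ t, l q * (dist q c ^ 2 - ‖q‖ ^ 2)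
      = l q * ρ - s ^ (e q + 1) * (l q * ε) - l q * ‖q‖ ^ 2 := by
    intro q hqt
    have := hq q hqt
    rw [← this]; ring
  rw [Finset.sum_congr rfl h1, Finset.sum_sub_distrib, Finset.sum_sub_distrib, ← Finset.sum_mul,
    hl] at key
  simp only [mem_ofPred_eq, Polynomial.IsRoot.def, f, Polynomial.eval_add, Polynomial.eval_sub,
    Polynomial.eval_monomial, Polynomial.eval_finsetSum, Polynomial.eval_C]
  have h2 : ∑ q ∈ t, l q * ε * s ^ (e q + 1) = ∑ q ∈ t, s ^ (e q + 1) * (l q * ε) :=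
    Finset.sum_congr rfl fun q _ => by ring
  rw [h2]
  linarith

theorem exists_isGenericWeight [FiniteDimensional ℝ E] {V : Set E} (hV : V.Countable)
    {ε : ℝ} (hε : 0 < ε) :
    ∃ w : E → ℝ, (∀ p, 0 < w p) ∧ (∀ p, w p ≤ ε) ∧ IsGenericWeight V w := by
  obtain ⟨e, he⟩ := Set.countable_iff_exists_injOn.1 hV
  have := hV.to_subtype
  -- All possible coincidences; the parameter `s` must avoid finitely many values for each of them.
  let ι := {q : Finset V × V // AffineIndependent ℝ ((↑) : q.1.map (.subtype _) → E) ∧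
    (q.1.map (.subtype _)).card = finrank ℝ E + 1 ∧ (q.2 : E) ∉ q.1.map (.subtype _)}
  let B : ι → Set ℝ := fun q => {s : ℝ | ∃ (c : E) (ρ : ℝ),
    (∀ x ∈ q.1.1.map (.subtype _), dist x c ^ 2 + ε * s ^ (e x + 1) = ρ) ∧
      dist (q.1.2 : E) c ^ 2 + ε * s ^ (e q.1.2 + 1) = ρ}
  have hB : (⋃ q, B q).Countable := Set.countable_iUnion fun q =>
    (finite_setOf_not_generic he hε (by
      intro x hx
      obtain ⟨y, -, rfl⟩ := Finset.mem_map.1 (Finset.mem_coe.1 hx)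
      exact y.2) q.2.1 q.2.2.1 q.1.2.2 q.2.2.2).countable
  obtain ⟨s, ⟨hs0, hs1⟩, hs⟩ :=
    (hB.dense_compl ℝ).inter_open_nonempty (Ioo 0 1) isOpen_Ioo ⟨1 / 2, by norm_num, by norm_num⟩
  refine ⟨fun p => ε * s ^ (e p + 1), fun p => by positivity, fun p => ?_, ?_⟩
  · exact mul_le_of_le_one_right hε.le (pow_le_one₀ hs0.le hs1.le)
  · classical
    intro t htV hind hcard p hp hpt c ρ hq hps
    have hmap : (t.subtype (· ∈ V)).map (.subtype _) = t :=
      Finset.subtype_map_of_mem fun x hx => htV hx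
    refine hs (mem_iUnion.2 ⟨⟨(t.subtype (· ∈ V), ⟨p, hp⟩), ?_, ?_, ?_⟩, c, ρ, ?_, hps⟩)
    · convert hind
    · convert hcard
    · convert hpt
    · convert hq

end PowerCells

/-! ### Spanning power cells cover the space -/

section Covering

/-- The strict inequalities that define a power cell are stable under small perturbations of the
center, uniformly over the infinitely many points: the far ones satisfy them with a large margin.-/
theorem eventually_forall_lt_power {X : Type*} [PseudoMetricSpace X]
    {V : Set X} {w : X → ℝ} {x : X}
    (hfin : ∀ r : ℝ, (V ∩ Metric.closedBall x r).Finite) (hw : ∀ p, 0 ≤ w p) {A : Set X} {c : X}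
    {m : ℝ} (h : ∀ p ∈ V, p ∉ A → m < dist p c ^ 2 + w p - dist x c ^ 2) :
    ∀ᶠ q : X × ℝ in 𝓝 (c, m), ∀ p ∈ V, p ∉ A → q.2 < dist p q.1 ^ 2 + w p - dist x q.1 ^ 2 := by
  set M : ℝ := 2 * (dist x c + 1) + |m| + 2 with hM
  have hnear : ∀ᶠ q : X × ℝ in 𝓝 (c, m), ∀ p ∈ V ∩ Metric.closedBall x M, p ∉ A →
      q.2 < dist p q.1 ^ 2 + w p - dist x q.1 ^ 2 := by
    refine (eventually_all_finite (hfin M)).2 fun p hp => ?_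
    by_cases hpA : p ∈ A
    · exact Eventually.of_forall fun q hq => absurd hpA hq
    · have h1 : Tendsto (fun q : X × ℝ => q.2) (𝓝 (c, m)) (𝓝 m) := continuous_snd.tendsto _
      have h2 : Tendsto (fun q : X × ℝ => dist p q.1 ^ 2 + w p - dist x q.1 ^ 2) (𝓝 (c, m))
          (𝓝 (dist p c ^ 2 + w p - dist x c ^ 2)) := by
        have : Continuous fun q : X × ℝ => dist p q.1 ^ 2 + w p - dist x q.1 ^ 2 := by fun_prop
        exact this.tendsto (c, m)
      filter_upwards [h1.eventually_lt h2 (h p hp.1 hpA)] with q hq _ using hq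
  have hc : ∀ᶠ q : X × ℝ in 𝓝 (c, m), dist q.1 c < 1 :=
    continuous_fst.tendsto (c, m) (Metric.ball_mem_nhds c one_pos)
  have hm : ∀ᶠ q : X × ℝ in 𝓝 (c, m), q.2 < m + 1 :=
    continuous_snd.tendsto (c, m) (Iio_mem_nhds (by simp))
  filter_upwards [hnear, hc, hm] with q hq hqc hqm p hp hpA
  by_cases hpM : p ∈ Metric.closedBall x M
  · exact hq p ⟨hp, hpM⟩ hpA
  · have hD : M < dist p x := by simpa using hpM
    have hδ : dist x q.1 ≤ dist x c + 1 := by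
      linarith [dist_triangle x c q.1, dist_comm c q.1]
    have htri : dist p x - dist x q.1 ≤ dist p q.1 := by
      linarith [dist_triangle p q.1 x, dist_comm x q.1]
    have h0 : 0 ≤ dist x q.1 := dist_nonneg
    have h0' : 0 ≤ dist x c := dist_nonneg
    have hm0 := abs_nonneg m
    have hpos : 0 ≤ dist p x - dist x q.1 := by linarith
    have h1 : (dist p x - dist x q.1) ^ 2 ≤ dist p q.1 ^ 2 := pow_le_pow_left₀ hpos htri 2
    have h2 : (|m| + 2) * 1 ≤ dist p x * (dist p x - 2 * dist x q.1) := by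
      refine mul_le_mul (by linarith) (by linarith) zero_le_one (by linarith)
    nlinarith [hw p, le_abs_self m]

variable {E : Type*} [NormedAddCommGroup E] [InnerProductSpace ℝ E]

/-- For `p` and `x` fixed, the difference of squared distances is affine in the center. -/
theorem dist_sq_sub_dist_sq_add_smul (p x c u : E) (δ : ℝ) :
    dist p (c + δ • u) ^ 2 - dist x (c + δ • u) ^ 2
      = dist p c ^ 2 - dist x c ^ 2 - 2 * δ * inner ℝ (p - x) u := by
  have h1 : ∀ y : E, dist y (c + δ • u) ^ 2 - dist y c ^ 2
      = 2 * inner ℝ y (-(δ • u)) + (‖c + δ • u‖ ^ 2 - ‖c‖ ^ 2) := by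
    intro y
    rw [dist_sq_sub_dist_sq]
    congr 3
    abel
  have h2 := h1 p
  have h3 := h1 x
  rw [inner_neg_right, real_inner_smul_right] at h2 h3
  rw [inner_sub_left]
  linarith

variable [FiniteDimensional ℝ E]

theorem exists_inner_le_neg {A : Set E} (hA : A.Finite) {x : E} (hx : x ∉ convexHull ℝ A) :
    ∃ (u : E) (η : ℝ), 0 < η ∧ ∀ p ∈ A, inner ℝ (p - x) u ≤ -η := by
  obtain ⟨f, k, hk, hfx⟩ := geometric_hahn_banach_closed_point (convex_convexHull ℝ A)
    (hA.isClosed_convexHull ℝ) hx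
  refine ⟨(InnerProductSpace.toDual ℝ E).symm f, f x - k, by linarith, fun p hp => ?_⟩
  rw [real_inner_comm, InnerProductSpace.toDual_symm_apply, map_sub]
  linarith [hk p (subset_convexHull ℝ A hp)]

theorem exists_inner_eq_zero {A : Set E} {x : E} (hx : x ∈ affineSpan ℝ A)
    (hA : affineSpan ℝ A ≠ ⊤) : ∃ u : E, u ≠ 0 ∧ ∀ p ∈ A, inner ℝ (p - x) u = 0 := by
  have hdir : (affineSpan ℝ A).direction ≠ ⊤ := fun h =>
    hA ((AffineSubspace.direction_eq_top_iff_of_nonempty ⟨x, hx⟩).1 h)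
  obtain ⟨u, hu, hu0⟩ := Submodule.exists_mem_ne_zero_of_ne_bot
    (mt Submodule.orthogonal_eq_bot_iff.1 hdir)
  exact ⟨u, hu0, fun p hp => hu _
    (AffineSubspace.vsub_mem_direction (subset_affineSpan ℝ A hp) hx)⟩

/-- Every point `x` lies in the convex hull of a power cell that spans the space. The center `c`
is chosen to maximize `m = min_p (dist p c ^ 2 + w p) - dist x c ^ 2` and, among the maximizers,
to maximize the distance to `x`. If `x` were not in the hull of the minimizing points `p`, moving
`c` away from them would increase `m`; if these points did not span, `c` could be moved in both
directions orthogonal to them, and one of the two would increase `dist x c`. -/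
theorem exists_isPowerCell_affineSpan_eq_top {V : Set E} {w : E → ℝ} {x : E} {R B : ℝ}
    (hR : ∀ y : E, ∃ p ∈ V, dist p y ≤ R)
    (hfin : ∀ r : ℝ, (V ∩ Metric.closedBall x r).Finite) (hw : ∀ p, 0 ≤ w p) (hwB : ∀ p, w p ≤ B) :
    ∃ t : Finset E, IsPowerCell V w t ∧ x ∈ convexHull ℝ (t : Set E) ∧
      affineSpan ℝ (t : Set E) = ⊤ := by
  -- The feasible pairs `(c, m)`; the pair `(x, 0)` is one, since the weights are nonnegative.
  set F : Set (E × ℝ) := {q | 0 ≤ q.2 ∧ ∀ p ∈ V, q.2 ≤ dist p q.1 ^ 2 + w p - dist x q.1 ^ 2}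
    with hF
  have hbound : ∀ q ∈ F, dist x q.1 ^ 2 ≤ R ^ 2 + B ∧ q.2 ≤ R ^ 2 + B := by
    rintro q ⟨hq0, hq⟩
    obtain ⟨p, hp, hpR⟩ := hR q.1
    have h1 := hq p hp
    have h2 : dist p q.1 ^ 2 ≤ R ^ 2 := pow_le_pow_left₀ dist_nonneg hpR 2
    constructor <;> linarith [hwB p, sq_nonneg (dist x q.1)]
  have hFclosed : IsClosed F := by
    have : F = {q | 0 ≤ q.2} ∩ ⋂ p ∈ V, {q | q.2 ≤ dist p q.1 ^ 2 + w p - dist x q.1 ^ 2} := by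
      ext q; simp [hF]
    rw [this]
    refine (isClosed_le continuous_const continuous_snd).inter
      (isClosed_biInter fun p _ => isClosed_le continuous_snd (by fun_prop))
  have hFcompact : IsCompact F := by
    refine ((isCompact_closedBall x (Real.sqrt (R ^ 2 + B))).prod
      (isCompact_Icc (a := 0) (b := R ^ 2 + B))).of_isClosed_subset hFclosed fun q hq => ?_
    obtain ⟨h1, h2⟩ := hbound q hq
    refine ⟨?_, hq.1, h2⟩
    rw [Metric.mem_closedBall, dist_comm]
    exact Real.le_sqrt_of_sq_le h1
  have hFne : F.Nonempty := ⟨(x, 0), le_rfl, fun p _ => by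
    simpa using add_nonneg (sq_nonneg (dist p x)) (hw p)⟩
  obtain ⟨⟨c₀, m⟩, hcm, hmax⟩ := hFcompact.exists_isMaxOn hFne continuous_snd.continuousOn
  have hGcompact : IsCompact (F ∩ {q | q.2 = m}) :=
    hFcompact.inter_right (isClosed_eq continuous_snd continuous_const)
  obtain ⟨⟨c, m'⟩, ⟨hc, hm'⟩, hcmax⟩ := hGcompact.exists_isMaxOn ⟨(c₀, m), hcm, rfl⟩
    (f := fun q => ‖q.1 - x‖ ^ 2) (by fun_prop)
  obtain rfl : m' = m := hm'
  set A : Set E := {p ∈ V | dist p c ^ 2 + w p - dist x c ^ 2 = m'} with hA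
  have hslack : ∀ p ∈ V, p ∉ A → m' < dist p c ^ 2 + w p - dist x c ^ 2 := fun p hp hpA =>
    lt_of_le_of_ne (hc.2 p hp) fun h => hpA ⟨hp, h.symm⟩
  have hev := eventually_forall_lt_power hfin hw hslack
  have hAfin : A.Finite := by
    refine (hfin (m' + 1 + 2 * dist x c)).subset fun p hp => ⟨hp.1, ?_⟩
    have h1 := hp.2
    have h2 := hc.1
    simp only at h2
    rw [Metric.mem_closedBall]
    by_contra! hlt
    have h3 : dist p x - dist x c ≤ dist p c := by
      linarith [dist_triangle p c x, dist_comm x c]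
    have h0 : 0 ≤ dist x c := dist_nonneg
    have h4 : (dist p x - dist x c) ^ 2 ≤ dist p c ^ 2 := pow_le_pow_left₀ (by linarith) h3 2
    have h5 : (m' + 1) * 1 ≤ dist p x * (dist p x - 2 * dist x c) :=
      mul_le_mul (by linarith) (by linarith) zero_le_one (by linarith)
    nlinarith [hw p]
  have hxA : x ∈ convexHull ℝ A := by
    by_contra hx
    -- Moving the center by `δ • u` gains at least `2 * δ * η` on `A`; half of it is enough.
    obtain ⟨u, η, hη, hu⟩ := exists_inner_le_neg hAfin hx
    have hpath : Tendsto (fun δ : ℝ => (c + δ • u, m' + η * δ)) (𝓝[>] 0) (𝓝 (c, m')) := by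
      have : Continuous fun δ : ℝ => (c + δ • u, m' + η * δ) := by fun_prop
      simpa using (this.tendsto 0).mono_left nhdsWithin_le_nhds
    obtain ⟨δ, hδ, hδ0⟩ := ((hpath.eventually hev).and self_mem_nhdsWithin).exists
    have hδ0 : 0 < δ := hδ0
    have hmem : (c + δ • u, m' + η * δ) ∈ F := by
      refine ⟨add_nonneg hc.1 (by positivity), fun p hp => ?_⟩
      by_cases hpA : p ∈ A
      · have h1 := dist_sq_sub_dist_sq_add_smul p x c u δ
        have h2 := mul_le_mul_of_nonneg_left (hu p hpA) hδ0.le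
        have h3 := hpA.2
        have h4 : 0 < δ * η := by positivity
        simp only
        nlinarith
      · exact (hδ p hp hpA).le
    have h1 : m' + η * δ ≤ m' := hmax hmem
    have h2 : 0 < η * δ := by positivity
    linarith
  have hspan : affineSpan ℝ A = ⊤ := by
    by_contra hne
    -- The centers `c ± δ • u` are optimal too, and one of them is farther from `x` than `c`.
    obtain ⟨u, hu0, hu⟩ := exists_inner_eq_zero (convexHull_subset_affineSpan A hxA) hne
    have hpath : Tendsto (fun δ : ℝ => (c + δ • u, m')) (𝓝 0) (𝓝 (c, m')) := by
      have : Continuous fun δ : ℝ => (c + δ • u, m') := by fun_prop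
      simpa using this.tendsto 0
    have hneg : Tendsto (fun δ : ℝ => -δ) (𝓝 0) (𝓝 0) := by
      simpa using (continuous_neg (G := ℝ)).tendsto 0
    have hboth := (hpath.eventually hev).and ((hpath.comp hneg).eventually hev)
    obtain ⟨δ, ⟨hδ, hδ'⟩, hδ0⟩ :=
      ((hboth.filter_mono nhdsWithin_le_nhds).and (self_mem_nhdsWithin (s := Ioi (0 : ℝ)))).exists
    have hδ0 : 0 < δ := hδ0
    have hmem : ∀ δ' : ℝ, (∀ p ∈ V, p ∉ A →
        m' < dist p (c + δ' • u) ^ 2 + w p - dist x (c + δ' • u) ^ 2) →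
        ‖c + δ' • u - x‖ ^ 2 ≤ ‖c - x‖ ^ 2 := by
      intro δ' h
      refine hcmax (show (c + δ' • u, m') ∈ F ∩ {q | q.2 = m'} from ⟨⟨hc.1, fun p hp => ?_⟩, rfl⟩)
      by_cases hpA : p ∈ A
      · have h1 := dist_sq_sub_dist_sq_add_smul p x c u δ'
        rw [hu p hpA] at h1
        have h3 := hpA.2
        simp only
        linarith
      · exact (h p hp hpA).le
    have h1 := hmem δ hδ
    have h2 := hmem (-δ) hδ'
    have hpar := parallelogram_law_with_norm ℝ (c - x) (δ • u)
    have e1 : c + δ • u - x = c - x + δ • u := by abel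
    have e2 : c + -δ • u - x = c - x - δ • u := by rw [neg_smul]; abel
    rw [e1] at h1
    rw [e2] at h2
    have h3 : 0 < ‖δ • u‖ := norm_pos_iff.2 (smul_ne_zero hδ0.ne' hu0)
    nlinarith
  refine ⟨hAfin.toFinset, ⟨fun p hp => ?_, c, m' + dist x c ^ 2, fun p hp => ?_,
    fun p hp hpA => ?_⟩, by simpa using hxA, by simpa using hspan⟩
  · exact ((hAfin.mem_toFinset).1 hp).1
  · linarith [((hAfin.mem_toFinset).1 hp).2]
  · linarith [hslack p hp fun h => hpA ((hAfin.mem_toFinset).2 h)]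

/-- For generic weights, a power cell that spans the space is a simplex. -/
theorem exists_simplex_isPowerCell {V : Set E} {w : E → ℝ} {x : E} {R B : ℝ}
    (hR : ∀ y : E, ∃ p ∈ V, dist p y ≤ R)
    (hfin : ∀ r : ℝ, (V ∩ Metric.closedBall x r).Finite) (hw : ∀ p, 0 ≤ w p) (hwB : ∀ p, w p ≤ B)
    (hgen : IsGenericWeight V w) :
    ∃ t : Finset E, IsPowerCell V w t ∧ x ∈ convexHull ℝ (t : Set E) ∧
      AffineIndependent ℝ ((↑) : t → E) ∧ t.card = finrank ℝ E + 1 := by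
  obtain ⟨t, ht, hxt, hspan⟩ := exists_isPowerCell_affineSpan_eq_top hR hfin hw hwB
  obtain ⟨s, hst, hsspan, hsind⟩ := exists_affineIndependent ℝ E (t : Set E)
  have hsfin : s.Finite := t.finite_toSet.subset hst
  lift s to Finset E using hsfin
  have hcard : s.card = finrank ℝ E + 1 := by
    have := hsind.affineSpan_eq_top_iff_card_eq_finrank_add_one.1 (by
      rw [Subtype.range_coe, hsspan, hspan])
    simpa using this
  obtain ⟨htV, c, ρ, hc, hc'⟩ := id ht
  have hts : t = s := by
    refine Finset.Subset.antisymm (fun p hp => ?_) (Finset.coe_subset.1 hst)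
    by_contra hps
    exact hgen s (hst.trans htV) hsind hcard p (htV hp) hps c ρ
      (fun q hq => hc q (hst hq)) (hc p hp)
  subst hts
  exact ⟨t, ht, hxt, hsind, hcard⟩

end Covering

/-! ### The weighted Delaunay triangulation -/

section PowerComplex

theorem isPowerCell_singleton {E : Type*} [NormedAddCommGroup E] {V : Set E} {w : E → ℝ} {a : E}
    (ha : a ∈ V) (hw : ∀ p, 0 ≤ w p) (hw8 : ∀ p, w p ≤ 1 / 8)
    (h : ∀ p ∈ V, p ≠ a → 1 ≤ dist p a) : IsPowerCell V w {a} := by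
  refine ⟨by simpa using ha, a, w a, by simp, fun p hp hpa => ?_⟩
  have h1 := h p hp (by simpa using hpa)
  nlinarith [hw p, hw8 a]

variable {E : Type*} [NormedAddCommGroup E] [InnerProductSpace ℝ E]

/-- Stewart's theorem. -/
theorem dist_sq_combination {α β : ℝ} (h : α + β = 1) (p a b : E) :
    dist p (α • a + β • b) ^ 2
      = α * dist p a ^ 2 + β * dist p b ^ 2 - α * β * dist a b ^ 2 := by
  have e1 : p - (α • a + β • b) = α • (p - a) + β • (p - b) := by
    rw [smul_sub, smul_sub]
    nth_rewrite 1 [← one_smul ℝ p]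
    rw [← h, add_smul]
    abel
  have e2 : a - b = (p - b) - (p - a) := by abel
  have e3 := norm_sub_sq_real (p - b) (p - a)
  rw [dist_eq_norm, dist_eq_norm, dist_eq_norm, dist_eq_norm, e1, e2, e3, norm_add_sq_real,
    norm_smul, norm_smul, real_inner_smul_left, real_inner_smul_right, mul_pow,
    mul_pow, Real.norm_eq_abs, Real.norm_eq_abs, sq_abs, sq_abs, real_inner_comm]
  obtain rfl : β = 1 - α := by linarith
  ring

/-- Two points of `V` at distance `1`, the minimal distance, form a power cell as long as the
weights are small: the center is a point of the segment close to its midpoint, and all other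
points of `V` are at distance at least `√3 / 2` from it. -/
theorem isPowerCell_pair [DecidableEq E] {V : Set E} {w : E → ℝ} {a b : E} (ha : a ∈ V)
    (hb : b ∈ V) (hab : dist a b = 1) (hw : ∀ p, 0 ≤ w p) (hw8 : ∀ p, w p ≤ 1 / 8)
    (h : V.Pairwise fun p q => 1 ≤ dist p q) : IsPowerCell V w {a, b} := by
  -- The center is shifted off the midpoint so that `a` and `b` have equal power.
  set κ : ℝ := (w b - w a) / 2 with hκ
  have hsum : (1 / 2 - κ) + (1 / 2 + κ) = 1 := by ring
  have hκ1 : κ ≤ 1 / 16 := by linarith [hw a, hw8 b]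
  have hκ2 : -(1 / 16) ≤ κ := by linarith [hw b, hw8 a]
  refine ⟨?_, (1 / 2 - κ) • a + (1 / 2 + κ) • b, (1 / 2 + κ) ^ 2 + w a, fun p hp => ?_,
    fun p hp hpn => ?_⟩
  · intro p hp
    rcases Finset.mem_insert.1 (Finset.mem_coe.1 hp) with rfl | hp
    · exact ha
    · rwa [Finset.mem_singleton.1 hp]
  · rw [dist_sq_combination hsum]
    rcases Finset.mem_insert.1 hp with rfl | hp
    · rw [hab, dist_self]; ring
    · rw [Finset.mem_singleton.1 hp, hab, dist_self, dist_comm b a, hab]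
      have : w b = w a + 2 * κ := by rw [hκ]; ring
      rw [this]; ring
  · rw [dist_sq_combination hsum, hab]
    simp only [Finset.mem_insert, Finset.mem_singleton, not_or] at hpn
    have h1 : 1 ≤ dist p a ^ 2 := one_le_pow₀ (h hp ha hpn.1)
    have h2 : 1 ≤ dist p b ^ 2 := one_le_pow₀ (h hp hb hpn.2)
    nlinarith [hw p, hw8 a, sq_nonneg κ]

/-- The weighted Delaunay triangulation of `V`, a simplicial complex: its faces are the nonempty
subsets of the full-dimensional simplices that are power cells. -/
def weightedDelaunay (V : Set E) (w : E → ℝ) : Geometry.SimplicialComplex ℝ E where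
  faces := {s | s.Nonempty ∧ ∃ t : Finset E, IsPowerCell V w t ∧
    AffineIndependent ℝ ((↑) : t → E) ∧ t.card = finrank ℝ E + 1 ∧ s ⊆ t}
  isRelLowerSet_faces := by
    rintro s ⟨hs, t, ht, hind, hcard, hst⟩
    exact ⟨hs, fun s' hs' hne => ⟨hne, t, ht, hind, hcard, hs'.trans hst⟩⟩
  indep := by
    rintro s ⟨-, t, -, hind, -, hst⟩
    exact hind.mono (Finset.coe_subset.2 hst)
  inter_subset_convexHull := by
    classical
    rintro s s' ⟨-, t, ht, hind, -, hst⟩ ⟨-, t', ht', hind', -, hst'⟩ x ⟨hx, hx'⟩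
    have hxt := ht.convexHull_inter_subset ht' ⟨convexHull_mono (Finset.coe_subset.2 hst) hx,
      convexHull_mono (Finset.coe_subset.2 hst') hx'⟩
    rw [← Finset.coe_inter] at hxt
    have h1 := (hind.convexHull_inter hst Finset.inter_subset_left).ge ⟨hx, hxt⟩
    have h2 := (hind'.convexHull_inter hst' Finset.inter_subset_right).ge ⟨hx', hxt⟩
    have h3 := (hind.convexHull_inter (t₁ := s ∩ (t ∩ t')) (t₂ := s' ∩ (t ∩ t'))
      (fun p hp => hst (Finset.mem_inter.1 hp).1)
      (fun p hp => (Finset.mem_inter.1 (Finset.mem_inter.1 hp).2).1)).ge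
      ⟨by rwa [Finset.coe_inter s], by rwa [Finset.coe_inter s']⟩
    refine convexHull_mono ?_ h3
    rintro p ⟨hp, hp'⟩
    exact ⟨(Finset.mem_inter.1 (Finset.mem_coe.1 hp)).1,
      (Finset.mem_inter.1 (Finset.mem_coe.1 hp')).1⟩

theorem weightedDelaunay_exists_simplex {V : Set E} {w : E → ℝ} {s : Finset E}
    (hs : s ∈ (weightedDelaunay V w).faces) :
    ∃ t ∈ (weightedDelaunay V w).faces, t.card = finrank ℝ E + 1 ∧ s ⊆ t := by
  obtain ⟨hne, t, ht, hind, hcard, hst⟩ := hs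
  exact ⟨t, ⟨hne.mono hst, t, ht, hind, hcard, subset_rfl⟩, hcard, hst⟩

theorem weightedDelaunay_face_subset {V : Set E} {w : E → ℝ} {s : Finset E}
    (hs : s ∈ (weightedDelaunay V w).faces) : (s : Set E) ⊆ V := by
  obtain ⟨hne, t, ht, hind, hcard, hst⟩ := hs
  exact (Finset.coe_subset.2 hst).trans ht.1

/-- The vertices of a simplex are almost at the same distance from the center of its power cell,
and this distance is bounded, since some point of the relatively dense set `V` is close to the
center. -/
theorem weightedDelaunay_exists_center {V : Set E} {w : E → ℝ} {R B : ℝ}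
    (hR : ∀ y : E, ∃ p ∈ V, dist p y ≤ R) (hw : ∀ p, 0 ≤ w p) (hwB : ∀ p, w p ≤ B) {s : Finset E}
    (hs : s ∈ (weightedDelaunay V w).faces) :
    ∃ c : E, (∀ p ∈ s, dist p c ^ 2 ≤ R ^ 2 + B) ∧
      ∀ p ∈ s, ∀ q ∈ s, dist p c ^ 2 - dist q c ^ 2 ≤ B := by
  obtain ⟨hne, t, ⟨htV, c, ρ, hc, hc'⟩, hind, hcard, hst⟩ := hs
  refine ⟨c, fun p hp => ?_, fun p hp q hq => ?_⟩
  · obtain ⟨q, hq, hqR⟩ := hR c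
    have h2 : dist q c ^ 2 ≤ R ^ 2 := pow_le_pow_left₀ dist_nonneg hqR 2
    have h3 := hc p (hst hp)
    by_cases hqt : q ∈ t
    · linarith [hc q hqt, hwB q, hw p]
    · linarith [hc' q hq hqt, hwB q, hw p]
  · linarith [hc p (hst hp), hc q (hst hq), hw p, hwB q]

/-- A power cell is a face as soon as some point of its convex hull is in the convex hull of no
proper subset. -/
theorem mem_weightedDelaunay_faces {V : Set E} {w : E → ℝ} {s : Finset E}
    (hcover : (weightedDelaunay V w).space = univ) (hs : IsPowerCell V w s)
    {x : E} (hx : x ∈ convexHull ℝ (s : Set E))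
    (hx' : ∀ s' ⊆ s, x ∈ convexHull ℝ (s' : Set E) → s' = s) :
    s ∈ (weightedDelaunay V w).faces := by
  classical
  have hxs : x ∈ (weightedDelaunay V w).space := hcover ▸ mem_univ x
  obtain ⟨s', ⟨hne, t, ht, hind, hcard, hst⟩, hxs'⟩ :=
    Geometry.SimplicialComplex.mem_space_iff.1 hxs
  have h1 := hs.convexHull_inter_subset ht ⟨hx, convexHull_mono (Finset.coe_subset.2 hst) hxs'⟩
  rw [← Finset.coe_inter] at h1
  have h2 := hx' _ Finset.inter_subset_left h1
  have h3 : s.Nonempty := by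
    rw [← Finset.coe_nonempty, ← convexHull_nonempty_iff (𝕜 := ℝ)]
    exact ⟨x, hx⟩
  exact ⟨h3, t, ht, hind, hcard, Finset.inter_eq_left.1 h2⟩

theorem weightedDelaunay_space [FiniteDimensional ℝ E] {V : Set E} {w : E → ℝ} {R B : ℝ}
    (hR : ∀ y : E, ∃ p ∈ V, dist p y ≤ R)
    (hfin : ∀ (x : E) (r : ℝ), (V ∩ Metric.closedBall x r).Finite) (hw : ∀ p, 0 ≤ w p)
    (hwB : ∀ p, w p ≤ B) (hgen : IsGenericWeight V w) : (weightedDelaunay V w).space = univ := by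
  refine eq_univ_of_forall fun x => ?_
  obtain ⟨t, ht, hxt, hind, hcard⟩ := exists_simplex_isPowerCell hR (hfin x) hw hwB hgen
  refine Geometry.SimplicialComplex.mem_space_iff.2
    ⟨t, ⟨?_, t, ht, hind, hcard, subset_rfl⟩, hxt⟩
  exact Finset.card_pos.1 (by omega)

theorem weightedDelaunay_vertices {V : Set E} {w : E → ℝ}
    (hcover : (weightedDelaunay V w).space = univ) (hw : ∀ p, 0 ≤ w p)
    (hw8 : ∀ p, w p ≤ 1 / 8) (h : V.Pairwise fun p q => 1 ≤ dist p q) :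
    (weightedDelaunay V w).vertices = V := by
  ext a
  refine ⟨fun ha => weightedDelaunay_face_subset ha (by simp), fun ha => ?_⟩
  refine mem_weightedDelaunay_faces hcover
    (isPowerCell_singleton ha hw hw8 fun p hp hne => h hp ha hne) (x := a) (by simp)
    fun s' hs' hx => ?_
  rcases Finset.subset_singleton_iff.1 hs' with rfl | h
  · simp at hx
  · exact h

theorem pair_mem_weightedDelaunay_faces [DecidableEq E] {V : Set E}
    {w : E → ℝ} (hcover : (weightedDelaunay V w).space = univ) (hw : ∀ p, 0 ≤ w p)
    (hw8 : ∀ p, w p ≤ 1 / 8) (h : V.Pairwise fun p q => 1 ≤ dist p q) {a b : E} (ha : a ∈ V)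
    (hb : b ∈ V) (hab : dist a b = 1) : {a, b} ∈ (weightedDelaunay V w).faces := by
  have hne : a ≠ b := by
    rintro rfl
    simp at hab
  refine mem_weightedDelaunay_faces hcover (isPowerCell_pair ha hb hab hw hw8 h)
    (x := midpoint ℝ a b) (by
      rw [Finset.coe_pair, convexHull_pair]; exact midpoint_mem_segment a b) fun s' hs' hx => ?_
  refine Finset.Subset.antisymm hs' fun p hp => ?_
  by_contra hps
  have hsub : ∀ q, s' ⊆ {q} → midpoint ℝ a b = q := fun q hq => by
    have := convexHull_mono (𝕜 := ℝ) (Finset.coe_subset.2 hq) hx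
    simpa using this
  rcases Finset.mem_insert.1 hp with rfl | hp
  · have := hsub b fun q hq => by
      rcases Finset.mem_insert.1 (hs' hq) with rfl | hq'
      · exact absurd hq hps
      · exact hq'
    exact hne ((midpoint_eq_right_iff ℝ).1 this)
  · obtain rfl := Finset.mem_singleton.1 hp
    have := hsub a fun q hq => by
      rcases Finset.mem_insert.1 (hs' hq) with rfl | hq'
      · simp
      · exact absurd (Finset.mem_singleton.1 hq' ▸ hq) hps
    exact hne ((midpoint_eq_left_iff ℝ).1 this)

theorem weightedDelaunay_finite_meet_closedBall {V : Set E} {w : E → ℝ} {R B : ℝ}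
    (hR : ∀ y : E, ∃ p ∈ V, dist p y ≤ R)
    (hfin : ∀ (x : E) (r : ℝ), (V ∩ Metric.closedBall x r).Finite)
    (hw : ∀ p, 0 ≤ w p) (hwB : ∀ p, w p ≤ B) (x : E) (r : ℝ) :
    {s ∈ (weightedDelaunay V w).faces |
      (convexHull ℝ (s : Set E) ∩ Metric.closedBall x r).Nonempty}.Finite := by
  set M := Real.sqrt (R ^ 2 + B)
  have hA := hfin x (r + 2 * M)
  refine hA.toFinset.powerset.finite_toSet.subset ?_
  rintro s ⟨hs, y, hy, hyx⟩
  rw [Finset.mem_coe, Finset.mem_powerset]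
  intro p hp
  refine hA.mem_toFinset.2 ⟨weightedDelaunay_face_subset hs hp, ?_⟩
  obtain ⟨c, hc, -⟩ := weightedDelaunay_exists_center hR hw hwB hs
  have hsub : (s : Set E) ⊆ Metric.closedBall c M := fun q hq => Real.le_sqrt_of_sq_le (hc q hq)
  have h1 : dist y c ≤ M := convexHull_min hsub (convex_closedBall c M) hy
  have h2 : dist p c ≤ M := hsub hp
  rw [Metric.mem_closedBall] at hyx ⊢
  linarith [dist_triangle p c x, dist_triangle c y x, dist_comm y c]

end PowerComplex

/-! ### The angle bound -/

section Angle

variable {E : Type*} [NormedAddCommGroup E] [InnerProductSpace ℝ E]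

theorem norm_inv_smul_sub_inv_smul_le_angle {u w : E} (hu : u ≠ 0) (hw : w ≠ 0) :
    ‖‖u‖⁻¹ • u - ‖w‖⁻¹ • w‖ ≤ InnerProductGeometry.angle u w := by
  refine le_of_sq_le_sq ?_ (InnerProductGeometry.angle_nonneg u w)
  have hu' := norm_ne_zero_iff.2 hu
  have hw' := norm_ne_zero_iff.2 hw
  have h1 := InnerProductGeometry.cos_angle u w
  have h2 := Real.one_sub_sq_div_two_le_cos (x := InnerProductGeometry.angle u w)
  rw [norm_sub_sq_real, norm_smul, norm_smul, real_inner_smul_left, real_inner_smul_right, norm_inv,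
    norm_inv, norm_norm, norm_norm, inv_mul_cancel₀ hu', inv_mul_cancel₀ hw']
  have h3 : ‖u‖⁻¹ * (‖w‖⁻¹ * inner ℝ u w) = Real.cos (InnerProductGeometry.angle u w) := by
    rw [h1]; field_simp
  rw [h3]
  linarith

/-- A quantitative form of the law of sines for three points on an approximate circle of radius at
most `M`. With `u`, `w` the sides at `v₂` and `z = c - v₂`, each of `‖u‖` and `‖w‖` is close to
twice the inner product of `z` with the corresponding unit vector; if the angle at `v₂` were
small, the two unit vectors, hence the two lengths, hence `v₁` and `v₃`, would be close together.-/
theorem le_angle_of_dist_sq_sub_le {v₁ v₂ v₃ c : E} {M : ℝ} (h12 : 1 ≤ dist v₁ v₂)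
    (h32 : 1 ≤ dist v₃ v₂) (h13 : 1 ≤ dist v₁ v₃) (h1 : dist v₁ c ≤ M) (h2 : dist v₂ c ≤ M)
    (hd1 : |dist v₁ c ^ 2 - dist v₂ c ^ 2| ≤ 1 / 8)
    (hd3 : |dist v₃ c ^ 2 - dist v₂ c ^ 2| ≤ 1 / 8) :
    3 / 4 ≤ 4 * M * EuclideanGeometry.angle v₁ v₂ v₃ := by
  set u := v₁ - v₂ with hu
  set w := v₃ - v₂ with hw
  set z := c - v₂ with hz
  have hθ : EuclideanGeometry.angle v₁ v₂ v₃ = InnerProductGeometry.angle u w := rfl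
  rw [hθ]
  rw [dist_eq_norm, ← hu] at h12
  rw [dist_eq_norm, ← hw] at h32
  have hu0 : u ≠ 0 := norm_pos_iff.1 (by linarith)
  have hw0 : w ≠ 0 := norm_pos_iff.1 (by linarith)
  have hle := norm_inv_smul_sub_inv_smul_le_angle hu0 hw0
  set θ := InnerProductGeometry.angle u w
  have huM : ‖u‖ ≤ 2 * M := by
    rw [hu, ← dist_eq_norm]
    linarith [dist_triangle v₁ c v₂, dist_comm v₂ c]
  have hzM : ‖z‖ ≤ M := by rwa [hz, ← dist_eq_norm, dist_comm]
  have key : ∀ v : E, dist v c ^ 2 - dist v₂ c ^ 2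
      = ‖v - v₂‖ ^ 2 - 2 * inner ℝ (v - v₂) z := by
    intro v
    have e1 : v - c = (v - v₂) - z := by rw [hz]; abel
    rw [dist_eq_norm v c, e1, norm_sub_sq_real, dist_comm v₂ c, dist_eq_norm c v₂]
    ring
  have key' : ∀ v : E, 1 ≤ ‖v - v₂‖ → |dist v c ^ 2 - dist v₂ c ^ 2| ≤ 1 / 8 →
      |‖v - v₂‖ - 2 * inner ℝ (‖v - v₂‖⁻¹ • (v - v₂)) z| ≤ 1 / 8 := by
    intro v hv hvd
    rw [key] at hvd
    have hv0 : 0 < ‖v - v₂‖ := by linarith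
    have e : ‖v - v₂‖ - 2 * inner ℝ (‖v - v₂‖⁻¹ • (v - v₂)) z
        = ‖v - v₂‖⁻¹ * (‖v - v₂‖ ^ 2 - 2 * inner ℝ (v - v₂) z) := by
      rw [real_inner_smul_left]; field_simp
    rw [e, abs_mul, abs_of_pos (inv_pos.2 hv0)]
    calc _ ≤ 1 * (1 / 8 : ℝ) :=
          mul_le_mul (inv_le_one_of_one_le₀ hv) hvd (abs_nonneg _) zero_le_one
      _ = _ := by ring
  have ku := abs_le.1 (key' v₁ h12 hd1)
  have kw := abs_le.1 (key' v₃ h32 hd3)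
  rw [← hu] at ku
  rw [← hw] at kw
  set u' := ‖u‖⁻¹ • u with hu'
  set w' := ‖w‖⁻¹ • w with hw'
  have hinner : |inner ℝ u' z - inner ℝ w' z| ≤ θ * M := by
    rw [← inner_sub_left]
    exact (abs_real_inner_le_norm _ _).trans
      (mul_le_mul hle hzM (norm_nonneg _) ((norm_nonneg _).trans hle))
  have hin := abs_le.1 hinner
  have hdiff : |‖u‖ - ‖w‖| ≤ 2 * (θ * M) + 1 / 4 := abs_le.2 ⟨by linarith, by linarith⟩
  have hw1 : ‖w'‖ = 1 := by
    rw [hw', norm_smul, norm_inv, norm_norm, inv_mul_cancel₀ (norm_ne_zero_iff.2 hw0)]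
  have hdecomp : v₁ - v₃ = ‖u‖ • (u' - w') + (‖u‖ - ‖w‖) • w' := by
    have e1 : ‖u‖ • u' = u := by rw [hu', smul_inv_smul₀ (norm_ne_zero_iff.2 hu0)]
    have e2 : ‖w‖ • w' = w := by rw [hw', smul_inv_smul₀ (norm_ne_zero_iff.2 hw0)]
    rw [smul_sub, sub_smul, e1, e2, hu, hw]
    abel
  have h5 : ‖v₁ - v₃‖ ≤ ‖u‖ * ‖u' - w'‖ + |‖u‖ - ‖w‖| := by
    rw [hdecomp]
    refine (norm_add_le _ _).trans ?_
    rw [norm_smul, norm_smul, hw1, mul_one, norm_norm, Real.norm_eq_abs]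
  have h6 : ‖u‖ * ‖u' - w'‖ ≤ 2 * M * θ :=
    mul_le_mul huM hle (norm_nonneg _) (by linarith [norm_nonneg u])
  rw [dist_eq_norm] at h13
  linarith

end Angle

/-! ### Faces of penny graphs -/

namespace PennyConfiguration

variable (P : PennyConfiguration)

theorem one_le_dist_center {i j : ℕ} (h : i ≠ j) : 1 ≤ dist (P.center i) (P.center j) := by
  have := (disjoint_ball_ball_iff (by norm_num) (by norm_num)).1 (P.disjoint_disks h)
  linarith

theorem pairwise_vertexSet : P.vertexSet.Pairwise fun p q => 1 ≤ dist p q := by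
  rintro _ ⟨i, rfl⟩ _ ⟨j, rfl⟩ h
  exact P.one_le_dist_center fun hij => h (by rw [hij])

theorem finite_center_mem_closedBall (x : Plane) (r : ℝ) :
    {i | P.center i ∈ Metric.closedBall x r}.Finite := by
  have h := Metric.isClosedEmbedding_of_pairwise_le_dist one_pos (f := P.center)
    fun i j hij => P.one_le_dist_center hij
  exact isCompact_iff_finite.1 (h.isCompact_preimage (isCompact_closedBall x r))

theorem finite_vertexSet_inter_closedBall (x : Plane) (r : ℝ) :
    (P.vertexSet ∩ Metric.closedBall x r).Finite := by
  refine ((P.finite_center_mem_closedBall x r).image P.center).subset ?_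
  rintro _ ⟨⟨i, rfl⟩, hi⟩
  exact ⟨i, hi, rfl⟩

theorem segment_subset_skeleton {i j : ℕ} (h : P.graph.Adj i j) :
    segment ℝ (P.center i) (P.center j) ⊆ P.skeleton :=
  fun _ hx => Or.inr ⟨i, j, h, hx⟩

theorem vertexSet_subset_skeleton : P.vertexSet ⊆ P.skeleton := subset_union_left

theorem exists_dist_center_le_half {z : Plane} (hz : z ∈ P.skeleton) :
    ∃ i, dist z (P.center i) ≤ 1 / 2 := by
  rcases hz with ⟨i, rfl⟩ | ⟨i, j, hij, hz⟩
  · exact ⟨i, by simp⟩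
  · have h1 := dist_add_dist_of_mem_segment hz
    have h2 : dist (P.center i) (P.center j) = 1 := hij
    by_contra! hlt
    linarith [hlt i, hlt j, dist_comm z (P.center i)]

theorem isClosed_skeleton : IsClosed P.skeleton := by
  -- Vertices are included as degenerate segments, to have one locally finite family.
  let S : ℕ × ℕ → Set Plane := fun q =>
    {x | (P.graph.Adj q.1 q.2 ∨ q.1 = q.2) ∧ x ∈ segment ℝ (P.center q.1) (P.center q.2)}
  have hS : P.skeleton = ⋃ q, S q := by
    ext x
    simp only [S, mem_iUnion, Prod.exists, mem_ofPred_eq]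
    constructor
    · rintro (⟨i, rfl⟩ | ⟨i, j, hij, hx⟩)
      · exact ⟨i, i, Or.inr rfl, left_mem_segment ℝ _ _⟩
      · exact ⟨i, j, Or.inl hij, hx⟩
    · rintro ⟨i, j, hij | rfl, hx⟩
      · exact Or.inr ⟨i, j, hij, hx⟩
      · rw [segment_same] at hx
        exact Or.inl ⟨i, hx.symm⟩
  rw [hS]
  refine LocallyFinite.isClosed_iUnion (fun x => ⟨Metric.closedBall x 1,
    Metric.closedBall_mem_nhds x one_pos, ?_⟩) fun q => ?_
  · have hfin := P.finite_center_mem_closedBall x 2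
    refine (hfin.prod hfin).subset ?_
    rintro ⟨i, j⟩ ⟨y, ⟨hij, hy⟩, hyx⟩
    have h1 : dist (P.center i) (P.center j) ≤ 1 := by
      rcases hij with h | h
      · exact le_of_eq h
      · simp only at h
        simp [h]
    have h2 := dist_add_dist_of_mem_segment hy
    rw [Metric.mem_closedBall] at hyx
    have h3 : 0 ≤ dist (P.center i) y := dist_nonneg
    have h4 : 0 ≤ dist y (P.center j) := dist_nonneg
    refine ⟨?_, ?_⟩ <;> simp only [mem_ofPred_eq, Metric.mem_closedBall]
    · linarith [dist_triangle (P.center i) y x]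
    · linarith [dist_triangle (P.center j) y x, dist_comm y (P.center j)]
  · by_cases h : P.graph.Adj q.1 q.2 ∨ q.1 = q.2
    · have : S q = segment ℝ (P.center q.1) (P.center q.2) := by ext x; simp [S, h]
      rw [this, ← convexHull_pair]
      exact ((Set.toFinite _).isCompact_convexHull ℝ).isClosed
    · have : S q = ∅ := by ext x; simp [S, h]
      rw [this]
      exact isClosed_empty

/-- An edge stays at distance at least `√3 / 2` from every vertex that is not one of its
endpoints. -/
theorem three_fourths_le_dist_sq {i j k : ℕ} (hj : i ≠ j) (hk : i ≠ k) (h : P.graph.Adj j k)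
    {z : Plane} (hz : z ∈ segment ℝ (P.center j) (P.center k)) :
    3 / 4 ≤ dist (P.center i) z ^ 2 := by
  obtain ⟨α, β, hα, hβ, hαβ, rfl⟩ := hz
  have h1 : dist (P.center j) (P.center k) = 1 := h
  rw [dist_sq_combination hαβ, h1]
  have h2 : 1 ≤ dist (P.center i) (P.center j) ^ 2 := one_le_pow₀ (P.one_le_dist_center hj)
  have h3 : 1 ≤ dist (P.center i) (P.center k) ^ 2 := one_le_pow₀ (P.one_le_dist_center hk)
  obtain rfl : β = 1 - α := by linarith
  nlinarith [sq_nonneg (α - 1 / 2)]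

theorem mem_segment_of_add_smul_mem_segment {p q y : Plane} (hpq : dist p q = 1)
    (hy : dist y p ^ 2 < 3 / 4) {s : ℝ} (hs : 0 < s) (h : p + s • (y - p) ∈ segment ℝ p q) :
    y ∈ segment ℝ p q := by
  rw [segment_eq_image'] at h ⊢
  obtain ⟨β, ⟨hβ0, hβ1⟩, h⟩ := h
  have h1 : β • (q - p) = s • (y - p) := add_left_cancel h
  have h2 : y - p = (s⁻¹ * β) • (q - p) := by
    rw [mul_smul, h1, inv_smul_smul₀ hs.ne']
  have h3 : dist y p = s⁻¹ * β := by
    rw [dist_eq_norm, h2, norm_smul, ← dist_eq_norm, dist_comm, hpq, mul_one, Real.norm_eq_abs,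
      abs_of_nonneg (by positivity)]
  refine ⟨s⁻¹ * β, ⟨by positivity, ?_⟩, ?_⟩
  · rw [← h3]
    nlinarith
  · simp only
    rw [← h2]
    abel

/-- Within distance `√3 / 2` of a vertex the penny graph consists of radial segments, so the
segment from a point off the graph to that vertex meets the graph only in the vertex. -/
theorem radial_notMem_skeleton {i : ℕ} {y : Plane} (hy : y ∉ P.skeleton)
    (hyi : dist y (P.center i) ^ 2 < 3 / 4) {s : ℝ} (hs : s ∈ Ioc (0 : ℝ) 1) :
    P.center i + s • (y - P.center i) ∉ P.skeleton := by
  have hdist : dist (P.center i) (P.center i + s • (y - P.center i)) ^ 2 < 3 / 4 := by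
    rw [dist_self_add_right, norm_smul, ← dist_eq_norm, Real.norm_eq_abs, abs_of_pos hs.1, mul_pow]
    have h1 : s ^ 2 ≤ 1 := pow_le_one₀ hs.1.le hs.2
    nlinarith [sq_nonneg (dist y (P.center i))]
  rintro (⟨j, hj⟩ | ⟨j, k, hjk, hz⟩)
  · rw [← hj] at hdist
    have hij : i = j := by
      by_contra hne
      have := P.one_le_dist_center hne
      nlinarith
    subst hij
    have h1 : s • (y - P.center i) = 0 := by simpa using hj.symm
    have h2 := (smul_eq_zero.1 h1).resolve_left hs.1.ne'
    exact hy (Or.inl ⟨i, (sub_eq_zero.1 h2).symm⟩)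
  · by_cases hij : i = j
    · subst hij
      exact hy (P.segment_subset_skeleton hjk (mem_segment_of_add_smul_mem_segment hjk hyi hs.1 hz))
    by_cases hik : i = k
    · subst hik
      rw [segment_symm] at hz
      exact hy (P.segment_subset_skeleton hjk.symm
        (mem_segment_of_add_smul_mem_segment hjk.symm hyi hs.1 hz))
    · linarith [P.three_fourths_le_dist_sq hij hik hjk hz]

variable {P}

theorem isOpen_face {σ : Set Plane} (hσ : σ ∈ P.faceSet) : IsOpen σ := by
  obtain ⟨x, hx, rfl⟩ := hσ
  exact P.isClosed_skeleton.isOpen_compl.connectedComponentIn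

theorem face_subset {σ : Set Plane} (hσ : σ ∈ P.faceSet) : σ ⊆ P.skeletonᶜ := by
  obtain ⟨x, hx, rfl⟩ := hσ
  exact connectedComponentIn_subset _ _

theorem subset_face {σ S : Set Plane} (hσ : σ ∈ P.faceSet) (hS : IsPreconnected S)
    (hSk : S ⊆ P.skeletonᶜ) (h : (S ∩ σ).Nonempty) : S ⊆ σ := by
  obtain ⟨x, hx, rfl⟩ := hσ
  obtain ⟨y, hyS, hy⟩ := h
  rw [connectedComponentIn_eq hy]
  exact hS.subset_connectedComponentIn hyS hSk

theorem frontier_face_subset {σ : Set Plane} (hσ : σ ∈ P.faceSet) : frontier σ ⊆ P.skeleton := by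
  intro z hz
  by_contra hzs
  have hτ : connectedComponentIn P.skeletonᶜ z ∈ P.faceSet := ⟨z, hzs, rfl⟩
  have hzτ := mem_connectedComponentIn (F := P.skeletonᶜ) hzs
  rw [(isOpen_face hσ).frontier_eq] at hz
  obtain ⟨y, hyτ, hyσ⟩ := mem_closure_iff.1 hz.1 _ (isOpen_face hτ) hzτ
  exact hz.2 (subset_face hσ isPreconnected_connectedComponentIn (face_subset hτ) ⟨y, hyτ, hyσ⟩ hzτ)

theorem center_mem_closure_face {σ : Set Plane} (hσ : σ ∈ P.faceSet) {z : Plane}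
    (hz : z ∈ closure σ) {i : ℕ} (hzi : dist z (P.center i) ^ 2 < 3 / 4) :
    P.center i ∈ closure σ := by
  have hopen : IsOpen {y : Plane | dist y (P.center i) ^ 2 < 3 / 4} :=
    isOpen_lt (by fun_prop) continuous_const
  obtain ⟨y, hyi, hyσ⟩ := mem_closure_iff.1 hz _ hopen hzi
  let f : ℝ → Plane := fun s => P.center i + s • (y - P.center i)
  have hf : Continuous f := by fun_prop
  have hsub : f '' Ioc 0 1 ⊆ σ := by
    refine subset_face hσ (isPreconnected_Ioc.image f hf.continuousOn) ?_
      ⟨y, ⟨1, by simp, by simp [f]⟩, hyσ⟩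
    rintro _ ⟨s, hs, rfl⟩
    exact P.radial_notMem_skeleton (face_subset hσ hyσ) hyi hs
  have h0 : f 0 ∈ closure (f '' Ioc 0 1) := by
    refine image_closure_subset_closure_image hf ⟨0, ?_, rfl⟩
    rw [closure_Ioc (by norm_num)]
    simp
  have := closure_mono hsub h0
  simpa [f] using this

/-- Every vertex of the closed polygon carries a corner of the face, namely the sector of any
point of the face near that vertex. -/
theorem encard_face_vertices_le {σ : Set Plane} (hσ : σ ∈ P.faceSet) :
    {i | P.center i ∈ closure σ}.encard ≤ P.facialDegree σ := by
  refine (encard_le_encard ?_).trans (encard_image_le Prod.fst (P.corners σ))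
  intro i hi
  obtain ⟨y, hyi, hyσ⟩ := mem_closure_iff.1 hi (P.disk i) Metric.isOpen_ball
    (Metric.mem_ball_self (by norm_num))
  have hy : y ∈ P.disk i \ P.skeleton := ⟨hyi, face_subset hσ hyσ⟩
  refine ⟨(i, connectedComponentIn (P.disk i \ P.skeleton) y), ⟨⟨y, hy, rfl⟩, ?_⟩, rfl⟩
  exact subset_face hσ isPreconnected_connectedComponentIn
    ((connectedComponentIn_subset _ _).trans fun z hz => hz.2)
    ⟨y, mem_connectedComponentIn hy, hyσ⟩

theorem exists_vertex_of_mem_frontier_face {σ : Set Plane} (hσ : σ ∈ P.faceSet) {z : Plane}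
    (hz : z ∈ frontier σ) : ∃ i, P.center i ∈ closure σ ∧ dist z (P.center i) ≤ 1 / 2 := by
  obtain ⟨i, hi⟩ := P.exists_dist_center_le_half (frontier_face_subset hσ hz)
  refine ⟨i, center_mem_closure_face hσ (frontier_subset_closure hz) ?_, hi⟩
  have : 0 ≤ dist z (P.center i) := dist_nonneg
  nlinarith

end PennyConfiguration

/-- In dimension at least two the complement of a closed ball is connected, being the image of the
product of a sphere and a ray. -/
theorem isPreconnected_setOf_lt_norm {E : Type*} [NormedAddCommGroup E] [NormedSpace ℝ E]
    (h : 1 < Module.rank ℝ E) {M : ℝ} (hM : 0 ≤ M) : IsPreconnected {x : E | M < ‖x‖} := by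
  have : {x : E | M < ‖x‖} = (fun q : E × ℝ => q.2 • q.1) '' (Metric.sphere 0 1 ×ˢ Ioi M) := by
    ext x
    constructor
    · intro hx
      have hx : M < ‖x‖ := hx
      have hx0 : ‖x‖ ≠ 0 := by linarith
      refine ⟨(‖x‖⁻¹ • x, ‖x‖), ⟨?_, hx⟩, ?_⟩
      · simp [norm_smul, hx0]
      · simp [smul_inv_smul₀ hx0]
    · rintro ⟨⟨u, r⟩, ⟨hu, hr⟩, rfl⟩
      have hu : ‖u‖ = 1 := by simpa using hu
      have hr : M < r := hr
      simp only [mem_ofPred_eq, norm_smul, hu, mul_one, Real.norm_eq_abs]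
      exact hr.trans_le (le_abs_self r)
  rw [this]
  refine ((isPreconnected_sphere h 0 1).prod isPreconnected_Ioi).image _ ?_
  fun_prop

namespace PennyConfiguration

variable {P : PennyConfiguration}

/-- The frontier of the face lies in finitely many disks, so if the face were unbounded it would
contain the complement of a large ball, and hence penny centers. -/
theorem isBounded_face {σ : Set Plane} (hσ : σ ∈ P.faceSet)
    (hfin : {i | P.center i ∈ closure σ}.Finite) : Bornology.IsBounded σ := by
  have hfr : Bornology.IsBounded (frontier σ) := by
    refine ((Bornology.isBounded_biUnion hfin).2 fun i _ =>
      Metric.isBounded_closedBall (x := P.center i) (r := 1 / 2)).subset fun z hz => ?_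
    obtain ⟨i, hi, hzi⟩ := exists_vertex_of_mem_frontier_face hσ hz
    exact mem_biUnion (show i ∈ {i | P.center i ∈ closure σ} from hi) hzi
  obtain ⟨M, hM0, hM⟩ := hfr.exists_pos_norm_le
  have hrank : 1 < Module.rank ℝ Plane := by
    rw [← Module.finrank_eq_rank, finrank_euclideanSpace_fin]
    norm_num
  have hE := isPreconnected_setOf_lt_norm hrank hM0.le
  by_contra hb
  have hmeet : ({x : Plane | M < ‖x‖} ∩ σ).Nonempty := by
    by_contra hempty
    refine hb (isBounded_iff_forall_norm_le.2 ⟨M, fun x hx => ?_⟩)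
    by_contra! hlt
    exact hempty ⟨x, hlt, hx⟩
  have hsub : {x : Plane | M < ‖x‖} ⊆ σ := by
    refine hE.subset_of_closure_inter_subset (isOpen_face hσ) hmeet ?_
    rintro x ⟨hxc, hx⟩
    by_contra hxσ
    have := hM x (by rw [(isOpen_face hσ).frontier_eq]; exact ⟨hxc, hxσ⟩)
    exact absurd hx (not_lt.2 this)
  obtain ⟨i, hi⟩ := (P.finite_center_mem_closedBall 0 M).infinite_compl.nonempty
  refine face_subset hσ (hsub (?_ : P.center i ∈ _)) (P.vertexSet_subset_skeleton ⟨i, rfl⟩)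
  simpa using hi

/-- A vertical line through a point of a bounded open set meets its frontier. -/
theorem exists_mem_frontier_of_mem {σ : Set Plane} (hopen : IsOpen σ) (hb : Bornology.IsBounded σ)
    {y : Plane} (hy : y ∈ σ) : ∃ z ∈ frontier σ, z 0 = y 0 := by
  by_contra! hne
  let e : Plane := EuclideanSpace.single 1 1
  let f : ℝ → Plane := fun s => y + s • e
  have hf : Continuous f := by fun_prop
  have hf0 : ∀ s, f s 0 = y 0 := fun s => by simp [f, e]
  have hsub : f '' univ ⊆ σ := by
    refine (isPreconnected_univ.image f hf.continuousOn).subset_of_closure_inter_subset hopen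
      ⟨y, ⟨0, trivial, by simp [f]⟩, hy⟩ ?_
    rintro _ ⟨hc, s, -, rfl⟩
    by_contra hn
    exact hne (f s) (by rw [hopen.frontier_eq]; exact ⟨hc, hn⟩) (hf0 s)
  obtain ⟨M, hM0, hM⟩ := hb.exists_pos_norm_le
  have h1 := hM _ (hsub ⟨2 * M + 1, trivial, rfl⟩)
  have h2 := hM y hy
  have h3 : ‖(2 * M + 1) • e‖ = 2 * M + 1 := by
    rw [norm_smul, Real.norm_eq_abs, abs_of_pos (by linarith)]
    simp [e]
  have h4 : (2 * M + 1) • e = f (2 * M + 1) - y := by simp [f]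
  have h5 := norm_sub_le (f (2 * M + 1)) y
  rw [← h4, h3] at h5
  linarith

/-- The disk projects to an interval of length `2 * r`, each point of which is the projection of a
frontier point of the face. But the frontier is covered by at most `D` disks of radius `1 / 2`,
whose projections have total length at most `D`. -/
theorem two_mul_radius_le {σ : Set Plane} (hσ : σ ∈ P.faceSet) {D : ℕ}
    (hD : P.facialDegree σ ≤ D) {x : Plane} {r : ℝ} (hr : Metric.ball x r ⊆ σ) :
    2 * r ≤ D := by
  have hcard := (encard_face_vertices_le hσ).trans hD
  have hfin : {i | P.center i ∈ closure σ}.Finite :=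
    finite_of_encard_le_coe hcard
  have hb := isBounded_face hσ hfin
  have hcover : Ioo (x 0 - r) (x 0 + r) ⊆
      ⋃ i ∈ hfin.toFinset, Icc (P.center i 0 - 1 / 2) (P.center i 0 + 1 / 2) := by
    intro τ hτ
    let y : Plane := x + (τ - x 0) • EuclideanSpace.single 0 1
    have hyσ : y ∈ σ := hr (by
      rw [Metric.mem_ball, dist_self_add_left, norm_smul, Real.norm_eq_abs]
      simpa using abs_lt.2 ⟨by linarith [hτ.1], by linarith [hτ.2]⟩)
    obtain ⟨z, hz, hzy⟩ := exists_mem_frontier_of_mem (isOpen_face hσ) hb hyσ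
    have hy0 : y 0 = τ := by simp [y]
    obtain ⟨i, hi, hzi⟩ := exists_vertex_of_mem_frontier_face hσ hz
    have h1 : |z 0 - P.center i 0| ≤ 1 / 2 := by
      refine le_trans ?_ hzi
      rw [dist_eq_norm]
      simpa using PiLp.norm_apply_le (z - P.center i) 0
    rw [hzy, hy0] at h1
    have := abs_le.1 h1
    exact mem_biUnion (hfin.mem_toFinset.2 hi) ⟨by linarith, by linarith⟩
  have hvol := (MeasureTheory.measure_mono (μ := MeasureTheory.volume) hcover).trans
    (MeasureTheory.measure_biUnion_finset_le _ _)
  have h1 : ∀ a : ℝ, a + 1 / 2 - (a - 1 / 2) = 1 := fun a => by ring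
  simp only [Real.volume_Ioo, Real.volume_Icc, h1, ENNReal.ofReal_one, Finset.sum_const,
    nsmul_eq_mul, mul_one] at hvol
  rw [hfin.encard_eq_coe_toFinset_card] at hcard
  have h2 : hfin.toFinset.card ≤ D := by exact_mod_cast hcard
  have h3 : x 0 + r - (x 0 - r) = 2 * r := by ring
  rw [h3] at hvol
  have h4 : (2 * r) ≤ (hfin.toFinset.card : ℝ) := by
    rw [← ENNReal.ofReal_natCast] at hvol
    exact (ENNReal.ofReal_le_ofReal_iff (Nat.cast_nonneg _)).1 hvol
  exact h4.trans (by exact_mod_cast h2)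

theorem facialDegree_le {D : ℕ} (hD : P.supFacialDegree ≤ D) {σ : Set Plane}
    (hσ : σ ∈ P.faceSet) : P.facialDegree σ ≤ D :=
  (le_iSup₂ (f := fun σ (_ : σ ∈ P.faceSet) => P.facialDegree σ) σ hσ).trans hD

theorem isBounded_face_of_supFacialDegree_le {D : ℕ} (hD : P.supFacialDegree ≤ D) {σ : Set Plane}
    (hσ : σ ∈ P.faceSet) : Bornology.IsBounded σ :=
  isBounded_face hσ
    (finite_of_encard_le_coe ((encard_face_vertices_le hσ).trans (facialDegree_le hD hσ)))

theorem exists_vertex_dist_le {D : ℕ} (hD : P.supFacialDegree ≤ D) (y : Plane) :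
    ∃ p ∈ P.vertexSet, dist p y ≤ D / 2 + 1 := by
  by_contra! hfar
  have hball : Metric.ball y (D / 2 + 1 / 2) ⊆ P.skeletonᶜ := by
    intro z hz hzs
    obtain ⟨i, hi⟩ := P.exists_dist_center_le_half hzs
    rw [Metric.mem_ball] at hz
    linarith [hfar _ ⟨i, rfl⟩, dist_triangle (P.center i) z y, dist_comm z (P.center i)]
  have hyb : y ∈ Metric.ball y ((D : ℝ) / 2 + 1 / 2) := Metric.mem_ball_self (by positivity)
  have hσ : connectedComponentIn P.skeletonᶜ y ∈ P.faceSet := ⟨y, hball hyb, rfl⟩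
  have hsub := (convex_ball y ((D : ℝ) / 2 + 1 / 2)).isPreconnected.subset_connectedComponentIn
    hyb hball
  linarith [two_mul_radius_le hσ (facialDegree_le hD hσ) hsub]

end PennyConfiguration

/-! ### Relative interiors of simplices -/

section PositiveHull

variable {E : Type*} [AddCommGroup E] [Module ℝ E]

/-- The points of the simplex `t` with positive barycentric coordinates, i.e. its relative
interior when `t` is affinely independent. -/
def positiveHull (t : Finset E) : Set E :=
  {x | ∃ a : E → ℝ, (∀ p ∈ t, 0 < a p) ∧ ∑ p ∈ t, a p = 1 ∧ ∑ p ∈ t, a p • p = x}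

theorem convex_positiveHull (t : Finset E) : Convex ℝ (positiveHull t) := by
  rintro x ⟨a, ha0, ha1, hax⟩ y ⟨b, hb0, hb1, hby⟩ α β hα hβ hαβ
  refine ⟨fun p => α * a p + β * b p, fun p hp => ?_, ?_, ?_⟩
  · have h1 := ha0 p hp
    have h2 := hb0 p hp
    rcases hα.eq_or_lt with rfl | hα'
    · rw [zero_add] at hαβ
      simpa [hαβ] using h2
    · positivity
  · rw [Finset.sum_add_distrib, ← Finset.mul_sum, ← Finset.mul_sum, ha1, hb1, mul_one, mul_one, hαβ]
  · simp only [add_smul, mul_smul, Finset.sum_add_distrib, ← Finset.smul_sum, hax, hby]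

theorem combination_mem_positiveHull {t : Finset E} {x g : E} (hx : x ∈ convexHull ℝ (t : Set E))
    (hg : g ∈ positiveHull t) {ε : ℝ} (hε : ε ∈ Ioc (0 : ℝ) 1) :
    (1 - ε) • x + ε • g ∈ positiveHull t := by
  obtain ⟨a, ha0, ha1, hax⟩ := Finset.mem_convexHull'.1 hx
  obtain ⟨b, hb0, hb1, hby⟩ := hg
  refine ⟨fun p => (1 - ε) * a p + ε * b p, fun p hp => ?_, ?_, ?_⟩
  · exact add_pos_of_nonneg_of_pos (mul_nonneg (by linarith [hε.2]) (ha0 p hp))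
      (mul_pos hε.1 (hb0 p hp))
  · rw [Finset.sum_add_distrib, ← Finset.mul_sum, ← Finset.mul_sum, ha1, hb1]
    ring
  · simp only [add_smul, mul_smul, Finset.sum_add_distrib, ← Finset.smul_sum, hax, hby]

theorem positiveHull_subset_convexHull (t : Finset E) :
    positiveHull t ⊆ convexHull ℝ (t : Set E) := by
  rintro x ⟨a, ha0, ha1, hax⟩
  exact Finset.mem_convexHull'.2 ⟨a, fun p hp => (ha0 p hp).le, ha1, hax⟩

theorem positiveHull_nonempty {t : Finset E} (ht : t.Nonempty) : (positiveHull t).Nonempty := by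
  have h0 : (0 : ℝ) < t.card := by exact_mod_cast ht.card_pos
  exact ⟨_, fun _ => (t.card : ℝ)⁻¹, fun _ _ => inv_pos.2 h0, by simp [h0.ne'], rfl⟩

theorem convexHull_subset_closure_positiveHull [TopologicalSpace E] [ContinuousAdd E]
    [ContinuousSMul ℝ E] (t : Finset E) :
    convexHull ℝ (t : Set E) ⊆ closure (positiveHull t) := by
  intro x hx
  have ht : t.Nonempty := by
    rw [← Finset.coe_nonempty, ← convexHull_nonempty_iff (𝕜 := ℝ)]
    exact ⟨x, hx⟩
  obtain ⟨g, hg⟩ := positiveHull_nonempty ht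
  have hf : Continuous fun ε : ℝ => (1 - ε) • x + ε • g := by fun_prop
  have h0 : (0 : ℝ) ∈ closure (Ioc 0 1) := by
    rw [closure_Ioc (by norm_num)]
    simp
  have h1 := image_closure_subset_closure_image hf ⟨0, h0, rfl⟩
  refine closure_mono ?_ (by simpa using h1)
  rintro _ ⟨ε, hε, rfl⟩
  exact combination_mem_positiveHull hx hg hε

theorem openSegment_subset_positiveHull [DecidableEq E] {v w : E} (h : v ≠ w) :
    openSegment ℝ v w ⊆ positiveHull {v, w} := by
  rintro x ⟨α, β, hα, hβ, hαβ, rfl⟩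
  refine ⟨fun p => if p = v then α else β, fun p _ => ?_, ?_, ?_⟩
  · dsimp only
    split_ifs <;> assumption
  · rw [Finset.sum_pair h, if_pos rfl, if_neg h.symm, hαβ]
  · simp [Finset.sum_pair h, h.symm]

theorem subset_of_mem_positiveHull {t s : Finset E} (hind : AffineIndependent ℝ ((↑) : t → E))
    {x : E} (hx : x ∈ positiveHull t) (hxs : x ∈ convexHull ℝ ((t : Set E) ∩ s)) : t ⊆ s := by
  classical
  obtain ⟨a, ha0, ha1, hax⟩ := hx
  rw [← Finset.coe_inter] at hxs
  obtain ⟨b, hb0, hb1, hbx⟩ := Finset.mem_convexHull'.1 hxs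
  have e1 : ∑ p ∈ t, (if p ∈ s then b p else 0) = 1 := by
    rw [← Finset.sum_filter, Finset.filter_mem_eq_inter, hb1]
  have e2 : ∑ p ∈ t, (if p ∈ s then b p else 0) • p = x := by
    simp only [ite_smul, zero_smul]
    rw [← Finset.sum_filter, Finset.filter_mem_eq_inter, hbx]
  have hz := (affineIndependent_iff.1 hind) Finset.univ
    (fun p => a p - if (p : E) ∈ s then b p else 0)
    (by
      rw [Finset.sum_coe_sort t (fun p => a p - if p ∈ s then b p else 0), Finset.sum_sub_distrib,
        ha1, e1, sub_self])
    (by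
      rw [Finset.sum_coe_sort t (fun p => (a p - if p ∈ s then b p else 0) • p)]
      simp only [sub_smul, Finset.sum_sub_distrib]
      rw [hax, e2, sub_self])
  intro p hp
  by_contra hps
  have h1 := hz ⟨p, hp⟩ (Finset.mem_univ _)
  simp only [hps, if_false, sub_zero] at h1
  exact (ha0 p hp).ne' h1

/-- If a simplex of `K` meets the relative interior of another one, it contains it as a face. -/
theorem subset_of_mem_positiveHull_of_mem_convexHull {K : Geometry.SimplicialComplex ℝ E}
    {s t : Finset E} (ht : t ∈ K.faces) (hs : s ∈ K.faces) {x : E} (hx : x ∈ positiveHull t)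
    (hxs : x ∈ convexHull ℝ (s : Set E)) : t ⊆ s :=
  subset_of_mem_positiveHull (K.indep ht) hx
    (K.inter_subset_convexHull ht hs ⟨positiveHull_subset_convexHull t hx, hxs⟩)

end PositiveHull

/-! ### From a triangulation that refines the graph to an associated triangulation -/

namespace PennyConfiguration

variable {P : PennyConfiguration}

/-- The subcomplex of those simplices of `K` that lie in the closed polygon `closure σ`. -/
def restrictToFace (K : Geometry.SimplicialComplex ℝ Plane) (σ : Set Plane) :
    Geometry.SimplicialComplex ℝ Plane where
  faces := {s ∈ K.faces | convexHull ℝ (s : Set Plane) ⊆ closure σ}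
  isRelLowerSet_faces := by
    rintro s ⟨hs, hsσ⟩
    refine ⟨K.nonempty_of_mem_faces hs, fun t hts hne => ⟨K.down_closed hs hts hne, ?_⟩⟩
    exact (convexHull_mono (Finset.coe_subset.2 hts)).trans hsσ
  indep := fun hs => K.indep hs.1
  inter_subset_convexHull := fun hs ht => K.inter_subset_convexHull hs.1 ht.1

/-- A triangulation `K` of the plane refines the penny graph: it is pure of dimension two, only
finitely many of its simplices meet a given disk, its vertices are the penny centers, and every
edge of the penny graph is one of its edges. -/
structure IsCompatible (P : PennyConfiguration) (K : Geometry.SimplicialComplex ℝ Plane) :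
    Prop where
  finite_meet : ∀ (x : Plane) (r : ℝ),
    {s ∈ K.faces | (convexHull ℝ (s : Set Plane) ∩ Metric.closedBall x r).Nonempty}.Finite
  space_eq : K.space = univ
  vertices_eq : K.vertices = P.vertexSet
  exists_triangle : ∀ s ∈ K.faces, ∃ t ∈ K.faces, t.card = 3 ∧ s ⊆ t
  exists_edge : ∀ i j, P.graph.Adj i j →
    ∃ s ∈ K.faces, (s : Set Plane) = {P.center i, P.center j}

namespace IsCompatible

variable {K : Geometry.SimplicialComplex ℝ Plane}

/-- The penny graph is covered by the vertices and the unit edges of `K`. -/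
theorem exists_face_of_mem_skeleton (hK : P.IsCompatible K) {z : Plane} (hz : z ∈ P.skeleton) :
    ∃ s ∈ K.faces, z ∈ convexHull ℝ (s : Set Plane) ∧ s.card ≤ 2 ∧
      ∀ v ∈ s, ∀ w ∈ s, v ≠ w → dist v w = 1 := by
  classical
  rcases hz with hz | ⟨i, j, hij, hz⟩
  · rw [← hK.vertices_eq] at hz
    refine ⟨{z}, hz, by simp, by simp, fun v hv w hw hne => ?_⟩
    rw [Finset.mem_singleton] at hv hw
    exact absurd (hv.trans hw.symm) hne
  · obtain ⟨s, hs, hsij⟩ := hK.exists_edge i j hij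
    have hs' : s = {P.center i, P.center j} := by
      rw [← Finset.coe_inj, hsij, Finset.coe_pair]
    have hd : dist (P.center i) (P.center j) = 1 := hij
    refine ⟨s, hs, by rwa [hsij, convexHull_pair], hs' ▸ Finset.card_le_two,
      fun v hv w hw hne => ?_⟩
    rw [hs', Finset.mem_insert, Finset.mem_singleton] at hv hw
    rcases hv with rfl | rfl <;> rcases hw with rfl | rfl
    · exact absurd rfl hne
    · exact hd
    · rwa [dist_comm]
    · exact absurd rfl hne

theorem positiveHull_subset_compl_skeleton (hK : P.IsCompatible K) {t : Finset Plane}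
    (ht : t ∈ K.faces) (hcard : t.card = 3) : positiveHull t ⊆ P.skeletonᶜ := by
  intro z hz hzs
  obtain ⟨s, hs, hzs', hcs, -⟩ := hK.exists_face_of_mem_skeleton hzs
  have := Finset.card_le_card (subset_of_mem_positiveHull_of_mem_convexHull ht hs hz hzs')
  omega

theorem openSegment_subset_compl_skeleton (hK : P.IsCompatible K) [DecidableEq Plane]
    {v w : Plane} (hs : {v, w} ∈ K.faces) (hne : v ≠ w) (hd : dist v w ≠ 1) :
    openSegment ℝ v w ⊆ P.skeletonᶜ := by
  intro z hz hzs
  obtain ⟨s, hs', hzs', -, hds⟩ := hK.exists_face_of_mem_skeleton hzs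
  have hsub := subset_of_mem_positiveHull_of_mem_convexHull hs hs'
    (openSegment_subset_positiveHull hne hz) hzs'
  exact hd (hds v (hsub (by simp)) w (hsub (by simp)) hne)

/-- A triangle that meets a face lies in the closed polygon of that face, since its relative
interior is connected and avoids the penny graph. -/
theorem convexHull_subset_closure_face (hK : P.IsCompatible K) {t : Finset Plane}
    (ht : t ∈ K.faces) (hcard : t.card = 3) {σ : Set Plane} (hσ : σ ∈ P.faceSet) {x : Plane}
    (hxt : x ∈ convexHull ℝ (t : Set Plane)) (hx : x ∈ σ) :
    convexHull ℝ (t : Set Plane) ⊆ closure σ := by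
  obtain ⟨y, hyσ, hyt⟩ := mem_closure_iff.1 (convexHull_subset_closure_positiveHull t hxt) σ
    (isOpen_face hσ) hx
  exact (convexHull_subset_closure_positiveHull t).trans <| closure_mono <|
    subset_face hσ (convex_positiveHull t).isPreconnected
      (hK.positiveHull_subset_compl_skeleton ht hcard) ⟨y, hyt, hyσ⟩

theorem finite_restrictToFace_faces (hK : P.IsCompatible K) {σ : Set Plane}
    (hb : Bornology.IsBounded σ) : (restrictToFace K σ).faces.Finite := by
  obtain ⟨r, hr⟩ := hb.closure.subset_closedBall 0
  refine (hK.finite_meet 0 r).subset ?_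
  rintro s ⟨hs, hsσ⟩
  obtain ⟨x, hx⟩ := (convexHull_nonempty_iff (𝕜 := ℝ)).2
    (Finset.coe_nonempty.2 (K.nonempty_of_mem_faces hs))
  exact ⟨hs, x, hx, hr (hsσ hx)⟩

theorem isDiagonalTriangulation (hK : P.IsCompatible K) {σ : Set Plane} (hσ : σ ∈ P.faceSet)
    (hb : Bornology.IsBounded σ) : P.IsDiagonalTriangulation σ (restrictToFace K σ) := by
  classical
  have hfin := hK.finite_restrictToFace_faces hb
  refine ⟨hfin, ?_, ?_, ?_, ?_⟩
  · refine Subset.antisymm (iUnion₂_subset fun s hs => hs.2) (closure_minimal ?_ ?_)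
    · intro x hx
      have hxK : x ∈ K.space := hK.space_eq ▸ mem_univ x
      obtain ⟨s, hs, hxs⟩ := Geometry.SimplicialComplex.mem_space_iff.1 hxK
      obtain ⟨t, ht, hcard, hst⟩ := hK.exists_triangle s hs
      have hxt := convexHull_mono (Finset.coe_subset.2 hst) hxs
      exact Geometry.SimplicialComplex.mem_space_iff.2
        ⟨t, ⟨ht, hK.convexHull_subset_closure_face ht hcard hσ hxt hx⟩, hxt⟩
    · exact hfin.isClosed_biUnion fun s _ =>
        (s.finite_toSet.isCompact_convexHull ℝ).isClosed
  · ext v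
    rw [faceVertices, ← hK.vertices_eq]
    refine and_congr_right fun _ => ?_
    simp
  · rintro s ⟨hs, hsσ⟩ hcard v hv w hw hne
    obtain rfl : {v, w} = s := Finset.eq_of_subset_of_card_le
      (by intro p hp; rcases Finset.mem_insert.1 hp with rfl | hp
          · exact hv
          · rwa [Finset.mem_singleton.1 hp]) (by rw [hcard, Finset.card_pair hne])
    rw [Finset.coe_pair, convexHull_pair] at hsσ
    have hvV : v ∈ P.vertexSet := hK.vertices_eq ▸
      K.down_closed hs (by simp) (Finset.singleton_nonempty v)
    have hwV : w ∈ P.vertexSet := hK.vertices_eq ▸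
      K.down_closed hs (by simp) (Finset.singleton_nonempty w)
    by_cases hd : dist v w = 1
    · left
      obtain ⟨i, rfl⟩ := hvV
      obtain ⟨j, rfl⟩ := hwV
      refine ⟨⟨i, j, hd, rfl, rfl⟩, fun z hz => ?_⟩
      rw [(isOpen_face hσ).frontier_eq]
      exact ⟨hsσ hz, fun hzσ => face_subset hσ hzσ (P.segment_subset_skeleton hd hz)⟩
    · right
      have hopen := hK.openSegment_subset_compl_skeleton hs hne hd
      refine ⟨hne, hsσ, ?_, ?_, ?_⟩
      · rintro ⟨⟨i, j, hij, rfl, rfl⟩, -⟩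
        exact hd hij
      · refine Subset.antisymm ?_ ?_
        · rintro z ⟨hz, hzV, -⟩
          rw [← insert_endpoints_openSegment] at hz
          rcases hz with rfl | rfl | hz
          · simp
          · simp
          · exact absurd (P.vertexSet_subset_skeleton hzV) (hopen hz)
        · rintro z (rfl | rfl)
          · exact ⟨left_mem_segment ℝ _ _, hvV, hsσ (left_mem_segment ℝ _ _)⟩
          · exact ⟨right_mem_segment ℝ _ _, hwV, hsσ (right_mem_segment ℝ _ _)⟩
      · rw [← disjoint_iff_inter_eq_empty]
        exact (disjoint_compl_left.mono_left hopen).mono_right (frontier_face_subset hσ)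
  · rintro v w ⟨⟨i, j, hij, rfl, rfl⟩, hfr⟩
    obtain ⟨s, hs, hsij⟩ := hK.exists_edge i j hij
    refine ⟨s, ⟨hs, ?_⟩, hsij⟩
    rw [hsij, convexHull_pair]
    exact hfr.trans frontier_subset_closure

theorem isAssociatedTriangulation (hK : P.IsCompatible K)
    (hb : ∀ σ ∈ P.faceSet, Bornology.IsBounded σ) : P.IsAssociatedTriangulation K where
  locallyFinite := fun x => ⟨Metric.closedBall x 1, Metric.closedBall_mem_nhds x one_pos, by
    refine ((hK.finite_meet x 1).preimage Subtype.val_injective.injOn).subset ?_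
    exact fun s hs => ⟨s.2, hs⟩⟩
  space_eq := hK.space_eq
  vertices_eq := hK.vertices_eq
  exists_diagonal := by
    refine ⟨restrictToFace K, fun σ hσ => hK.isDiagonalTriangulation hσ (hb σ hσ), ?_⟩
    refine Subset.antisymm (fun s hs => ?_) (iUnion₂_subset fun σ _ s hs => hs.1)
    obtain ⟨t, ht, hcard, hst⟩ := hK.exists_triangle s hs
    obtain ⟨x, hx⟩ := positiveHull_nonempty (K.nonempty_of_mem_faces ht)
    have hxs := hK.positiveHull_subset_compl_skeleton ht hcard hx
    have hσ : connectedComponentIn P.skeletonᶜ x ∈ P.faceSet := ⟨x, hxs, rfl⟩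
    have hxt := positiveHull_subset_convexHull t hx
    refine mem_iUnion₂.2 ⟨_, hσ, hs, (convexHull_mono (Finset.coe_subset.2 hst)).trans ?_⟩
    exact hK.convexHull_subset_closure_face ht hcard hσ hxt (mem_connectedComponentIn hxs)

end IsCompatible

theorem isCompatible_weightedDelaunay {R : ℝ}
    (hR : ∀ y : Plane, ∃ p ∈ P.vertexSet, dist p y ≤ R) {w : Plane → ℝ} (hw : ∀ p, 0 ≤ w p)
    (hw8 : ∀ p, w p ≤ 1 / 8) (hgen : IsGenericWeight P.vertexSet w) :
    P.IsCompatible (weightedDelaunay P.vertexSet w) := by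
  classical
  have hspace := weightedDelaunay_space hR P.finite_vertexSet_inter_closedBall hw hw8 hgen
  refine ⟨weightedDelaunay_finite_meet_closedBall hR P.finite_vertexSet_inter_closedBall hw hw8,
    hspace, weightedDelaunay_vertices hspace hw hw8 P.pairwise_vertexSet, fun s hs => ?_,
    fun i j hij => ?_⟩
  · simpa using weightedDelaunay_exists_simplex hs
  · exact ⟨_, pair_mem_weightedDelaunay_faces hspace hw hw8 P.pairwise_vertexSet ⟨i, rfl⟩ ⟨j, rfl⟩
      hij, Finset.coe_pair⟩

end PennyConfiguration

theorem lemma3p6 (D : ℕ) :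
    ∃ C : ℝ, 0 < C ∧
      ∀ P : PennyConfiguration, P.graph.Connected → P.supFacialDegree ≤ (D : ℕ∞) →
        ∃ K : Geometry.SimplicialComplex ℝ Plane, P.IsAssociatedTriangulation K ∧
          ∀ τ ∈ K.faces, τ.card = 3 →
            ∀ v₁ ∈ τ, ∀ v₂ ∈ τ, ∀ v₃ ∈ τ, v₁ ≠ v₂ → v₂ ≠ v₃ → v₁ ≠ v₃ →
              1 / C ≤ EuclideanGeometry.angle v₁ v₂ v₃ ∧
                1 ≤ dist v₁ v₂ ∧ dist v₁ v₂ ≤ C := by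
  set M : ℝ := (D / 2 + 1) + 1 with hM
  have hMpos : 0 < M := by positivity
  refine ⟨6 * M, by positivity, fun P _ hD => ?_⟩
  obtain ⟨w, hw0, hw8, hgen⟩ := exists_isGenericWeight
    (countable_range P.center : P.vertexSet.Countable) (ε := 1 / 8) (by norm_num)
  have hw : ∀ p, 0 ≤ w p := fun p => (hw0 p).le
  have hR := PennyConfiguration.exists_vertex_dist_le hD
  refine ⟨weightedDelaunay P.vertexSet w,
    (PennyConfiguration.isCompatible_weightedDelaunay hR hw hw8 hgen).isAssociatedTriangulation
      fun σ hσ => PennyConfiguration.isBounded_face_of_supFacialDegree_le hD hσ, ?_⟩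
  intro τ hτ _ v₁ h₁ v₂ h₂ v₃ h₃ h12 h23 h13
  obtain ⟨c, hc, hcd⟩ := weightedDelaunay_exists_center hR hw hw8 hτ
  have hV := weightedDelaunay_face_subset hτ
  have hcM : ∀ v ∈ τ, dist v c ≤ M := fun v hv => by
    refine le_of_sq_le_sq ((hc v hv).trans ?_) hMpos.le
    have : (0 : ℝ) ≤ D / 2 + 1 := by positivity
    rw [hM]
    nlinarith
  have hsep := P.pairwise_vertexSet
  have hang := le_angle_of_dist_sq_sub_le (hsep (hV h₁) (hV h₂) h12) (hsep (hV h₃) (hV h₂) h23.symm)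
    (hsep (hV h₁) (hV h₃) h13) (hcM v₁ h₁) (hcM v₂ h₂)
    (abs_le.2 ⟨by linarith [hcd v₂ h₂ v₁ h₁], hcd v₁ h₁ v₂ h₂⟩)
    (abs_le.2 ⟨by linarith [hcd v₂ h₂ v₃ h₃], hcd v₃ h₃ v₂ h₂⟩)
  refine ⟨?_, hsep (hV h₁) (hV h₂) h12, ?_⟩
  · rw [div_le_iff₀ (by positivity)]
    linarith
  · linarith [dist_triangle v₁ c v₂, dist_comm v₂ c, hcM v₁ h₁, hcM v₂ h₂]
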